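/- Let $p$ be a prime number and $q=p^d$ with $d\ge 1$. For a field $F$ containing a primitive $q$th root of unity let $G_F=\mathrm{Gal}(F_{\mathrm{sep}}/F)$ be its absolute Galois group, and let $H^r(G_F)=H^r(G_F,\mathbb{Z}/q)$ be its (continuous) cohomology with the trivial action on $\mathbb{Z}/q$. Let $\cup\colon H^1(G_F)\times H^1(G_F)\to H^2(G_F)$ be the cup product, and let $\beta\colon H^1(G_F)\to H^2(G_F)$ be the Bockstein homomorphism, i.e., the connecting homomorphism of $0\to\mathbb{Z}/q\to\mathbb{Z}/q^2\to\mathbb{Z}/q\to 0$. For a profinite group $G$ set $G^{(1)}=G$, let $G^{(i+1)}$ be the closed subgroup of $G$ topologically generated by all $h^q$ and all $h^{-1}g^{-1}hg$ with $h\in G^{(i)}$, $g\in G$, and set $G^{[i]}=G/G^{(i)}$. Then $G_F^{[3]}$ is determined up to isomorphism by $H^1(G_F)$, $H^2(G_F)$, $\cup$ and $\beta$. That is: let $F_1,F_2$ be fields containing a primitive $q$th root of unity, and let $\varphi_r\colon H^r(G_{F_1})\to H^r(G_{F_2})$, $r=1,2$, be group isomorphisms such that $\varphi_2(a\cup b)=\varphi_1(a)\cup\varphi_1(b)$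 and $\varphi_2(\beta(a))=\beta(\varphi_1(a))$ for all $a,b\in H^1(G_{F_1})$. Then $G_{F_1}^{[3]}$ and $G_{F_2}^{[3]}$ are isomorphic as topological groups. -/

import Mathlib

noncomputable section

namespace GaloisQuotient

/-! ### Continuous cohomology in degrees one and two, with trivial coefficients

`G` is a topological group and `M` a topological abelian group (below: `ZMod q` with the discrete
topology) on which `G` acts trivially. The groups `Hⁿ(G, M)` are computed by the complex of
continuous inhomogeneous cochains `C(Gⁿ, M)`. -/

section Cohomology

variable (G : Type*) [Group G] [TopologicalSpace G] [IsTopologicalGroup G]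
variable (M : Type*) [AddCommGroup M] [TopologicalSpace M] [IsTopologicalAddGroup M]

/-- The differential from `1`-cochains to `2`-cochains, `(d f)(g, h) = f h - f (g h) + f g`. -/
def d₁ : C(G, M) →+ C(G × G, M) where
  toFun f := ⟨fun x => f x.2 - f (x.1 * x.2) + f x.1, by fun_prop⟩
  map_zero' := by ext; simp
  map_add' f f' := by ext; simp; abel

/-- The differential from `2`-cochains to `3`-cochains,
`(d c)(g, h, k) = c (h, k) - c (g h, k) + c (g, h k) - c (g, h)`. -/
def d₂ : C(G × G, M) →+ C(G × G × G, M) where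
  toFun c := ⟨fun x => c (x.2.1, x.2.2) - c (x.1 * x.2.1, x.2.2) + c (x.1, x.2.1 * x.2.2)
    - c (x.1, x.2.1), by fun_prop⟩
  map_zero' := by ext; simp
  map_add' c c' := by ext; simp; abel

variable {G M} in
@[simp] theorem d₁_apply (f : C(G, M)) (x : G × G) :
    d₁ G M f x = f x.2 - f (x.1 * x.2) + f x.1 := rfl

variable {G M} in
@[simp] theorem d₂_apply (c : C(G × G, M)) (x : G × G × G) :
    d₂ G M c x = c (x.2.1, x.2.2) - c (x.1 * x.2.1, x.2.2) + c (x.1, x.2.1 * x.2.2)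
      - c (x.1, x.2.1) := rfl

variable {G M} in
theorem d₂_d₁ (f : C(G, M)) : d₂ G M (d₁ G M f) = 0 := by
  ext x
  simp [mul_assoc]
  abel

/-- `H¹(G, M)`: as the action is trivial, the differential `C(G⁰, M) → C(G, M)` is zero, so this
is the group of continuous `1`-cocycles, i.e. of continuous homomorphisms `G → M`. -/
abbrev H1 : Type _ := (d₁ G M).ker

/-- `H²(G, M)`: continuous `2`-cocycles modulo the coboundaries of continuous `1`-cochains. -/
abbrev H2 : Type _ := (d₂ G M).ker ⧸ (d₁ G M).range.addSubgroupOf (d₂ G M).ker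

variable {G M}

theorem H1.map_mul (a : H1 G M) (g h : G) : a.1 (g * h) = a.1 g + a.1 h := by
  have h₁ := DFunLike.congr_fun (AddMonoidHom.mem_ker.1 a.2) (g, h)
  simp only [d₁_apply, ContinuousMap.zero_apply] at h₁
  rw [← sub_eq_zero, ← neg_eq_zero, ← h₁]
  abel

/-- The class in `H²(G, M)` of a continuous `2`-cocycle. -/
def H2.mk (c : C(G × G, M)) (hc : d₂ G M c = 0) : H2 G M :=
  QuotientAddGroup.mk ⟨c, hc⟩

theorem H2.mk_eq_mk_iff {c c' : C(G × G, M)} {hc : d₂ G M c = 0} {hc' : d₂ G M c' = 0} :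
    H2.mk c hc = H2.mk c' hc' ↔ ∃ f : C(G, M), c' = c + d₁ G M f := by
  rw [H2.mk, H2.mk, QuotientAddGroup.eq, AddSubgroup.mem_addSubgroupOf]
  refine exists_congr fun f => ?_
  change d₁ G M f = -c + c' ↔ c' = c + d₁ G M f
  rw [eq_neg_add_iff_add_eq, eq_comm]

theorem H2.mk_add_mk {c c' : C(G × G, M)} (hc : d₂ G M c = 0) (hc' : d₂ G M c' = 0) :
    H2.mk c hc + H2.mk c' hc' = H2.mk (c + c') (by rw [map_add, hc, hc', add_zero]) := rfl

end Cohomology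

/-! ### The cup product `H¹ × H¹ → H²` -/

section Cup

variable {G : Type*} [Group G] [TopologicalSpace G] [IsTopologicalGroup G]
variable {A : Type*} [CommRing A] [TopologicalSpace A] [IsTopologicalRing A]

/-- The cup product of `1`-cochains, `(a ∪ b)(g, h) = a g * b h`. -/
def cupCochain (a b : C(G, A)) : C(G × G, A) := ⟨fun x => a x.1 * b x.2, by fun_prop⟩

theorem d₂_cupCochain (a b : H1 G A) : d₂ G A (cupCochain a.1 b.1) = 0 := by
  ext x
  simp only [d₂_apply, cupCochain, ContinuousMap.coe_mk, H1.map_mul, ContinuousMap.zero_apply]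
  ring

/-- The cup product `H¹(G, A) × H¹(G, A) → H²(G, A)`, induced by the multiplication of `A`. -/
def cup : H1 G A →+ H1 G A →+ H2 G A :=
  AddMonoidHom.mk' (fun a => AddMonoidHom.mk'
    (fun b => H2.mk (cupCochain a.1 b.1) (d₂_cupCochain a b))
    (fun b b' => by
      rw [H2.mk_add_mk, H2.mk_eq_mk_iff]
      exact ⟨0, by ext x; simp [cupCochain, mul_add]⟩))
    (fun a a' => by
      ext b
      simp only [AddMonoidHom.mk'_apply, AddMonoidHom.add_apply]
      rw [H2.mk_add_mk, H2.mk_eq_mk_iff]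
      exact ⟨0, by ext x; simp [cupCochain, add_mul]⟩)

end Cup

/-! ### The Bockstein homomorphism

It is the connecting homomorphism `H¹(G, ℤ/q) → H²(G, ℤ/q)` of the short exact sequence of trivial
modules `0 → ℤ/q → ℤ/q² → ℤ/q → 0`. -/

section Bockstein

variable (q : ℕ)

/-- The injection `ℤ/q → ℤ/q²`, which maps the class of `n` to the class of `n q`. -/
def incl : ZMod q →+ ZMod (q ^ 2) :=
  ZMod.lift q ⟨(AddMonoidHom.mulRight (q : ZMod (q ^ 2))).comp (Int.castAddHom (ZMod (q ^ 2))), by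
    change ((q : ℤ) : ZMod (q ^ 2)) * (q : ZMod (q ^ 2)) = 0
    rw [Int.cast_natCast, ← Nat.cast_mul, ← sq, ZMod.natCast_self]⟩

/-- The reduction map `ℤ/q² → ℤ/q`. -/
def proj : ZMod (q ^ 2) →+ ZMod q :=
  (ZMod.castHom (dvd_pow_self q two_ne_zero) (ZMod q)).toAddMonoidHom

theorem incl_intCast (n : ℤ) : incl q n = (n * q : ℤ) := by
  rw [incl, ZMod.lift_coe]
  simp

theorem proj_intCast (n : ℤ) : proj q n = n := 
  map_intCast (ZMod.castHom (dvd_pow_self q two_ne_zero) (ZMod q)) n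

theorem proj_surjective : Function.Surjective (proj q) := fun x => by
  obtain ⟨n, rfl⟩ := ZMod.intCast_surjective x
  exact ⟨n, proj_intCast q n⟩

theorem incl_injective [NeZero q] : Function.Injective (incl q) := by
  rw [injective_iff_map_eq_zero]
  intro x hx
  obtain ⟨n, rfl⟩ := ZMod.intCast_surjective x
  rw [incl_intCast, ZMod.intCast_zmod_eq_zero_iff_dvd] at hx
  rw [ZMod.intCast_zmod_eq_zero_iff_dvd]
  push_cast at hx
  rw [sq] at hx
  exact Int.dvd_of_mul_dvd_mul_right (by exact_mod_cast NeZero.ne q) hx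

theorem proj_eq_zero_iff (x : ZMod (q ^ 2)) : proj q x = 0 ↔ ∃ y, incl q y = x := by
  constructor
  · intro hx
    obtain ⟨n, rfl⟩ := ZMod.intCast_surjective x
    rw [proj_intCast, ZMod.intCast_zmod_eq_zero_iff_dvd] at hx
    obtain ⟨m, rfl⟩ := hx
    exact ⟨m, by rw [incl_intCast, mul_comm]⟩
  · rintro ⟨y, rfl⟩
    obtain ⟨n, rfl⟩ := ZMod.intCast_surjective y
    rw [incl_intCast, proj_intCast]
    simp

variable {q} {G : Type*} [Group G] [TopologicalSpace G] [IsTopologicalGroup G]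

/-- A continuous lift of a homomorphism `a : G → ℤ/q` to a `1`-cochain with values in `ℤ/q²`. -/
def liftCochain (a : H1 G (ZMod q)) : C(G, ZMod (q ^ 2)) :=
  ⟨fun g => Function.surjInv (proj_surjective q) (a.1 g), by fun_prop⟩

/-- The `2`-cochain with values in `ℤ/q` whose image in `ℤ/q²` is the coboundary of
`liftCochain a`. -/
def bocksteinCochain (a : H1 G (ZMod q)) : C(G × G, ZMod q) :=
  ⟨fun x => Function.invFun (incl q) (d₁ G (ZMod (q ^ 2)) (liftCochain a) x), by fun_prop⟩

theorem proj_liftCochain (a : H1 G (ZMod q)) (g : G) : proj q (liftCochain a g) = a.1 g :=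
  Function.surjInv_eq (proj_surjective q) (a.1 g)

theorem incl_bocksteinCochain (a : H1 G (ZMod q)) (x : G × G) :
    incl q (bocksteinCochain a x) = d₁ G (ZMod (q ^ 2)) (liftCochain a) x := by
  refine Function.invFun_eq ((proj_eq_zero_iff q _).1 ?_)
  simp [proj_liftCochain, H1.map_mul]

variable [NeZero q]

/-- If the image of a cochain `c` in `ℤ/q²` is a coboundary, then `c` is a cocycle. -/
theorem d₂_eq_zero_of_incl {c : C(G × G, ZMod q)} {f : C(G, ZMod (q ^ 2))}
    (h : ∀ x, incl q (c x) = d₁ G (ZMod (q ^ 2)) f x) : d₂ G (ZMod q) c = 0 := by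
  ext x
  apply incl_injective q
  have h₂ := DFunLike.congr_fun (d₂_d₁ f) x
  simp only [d₂_apply] at h₂ ⊢
  simp only [map_add, map_sub, h, h₂, ContinuousMap.zero_apply, map_zero]

/-- The class of a cocycle obtained from a lift of `a` does not depend on the lift. -/
theorem mk_bocksteinCochain_eq (a : H1 G (ZMod q)) {c : C(G × G, ZMod q)}
    {f : C(G, ZMod (q ^ 2))} (hf : ∀ g, proj q (f g) = a.1 g)
    (h : ∀ x, incl q (c x) = d₁ G (ZMod (q ^ 2)) f x) :
    H2.mk (bocksteinCochain a) (d₂_eq_zero_of_incl (incl_bocksteinCochain a)) =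
      H2.mk c (d₂_eq_zero_of_incl h) := by
  rw [H2.mk_eq_mk_iff]
  have h₁ : ∀ g, ∃ y, incl q y = f g - liftCochain a g := fun g =>
    (proj_eq_zero_iff q _).1 (by rw [map_sub, hf, proj_liftCochain, sub_self])
  refine ⟨⟨fun g => Function.invFun (incl q) (f g - liftCochain a g), by fun_prop⟩, ?_⟩
  ext x
  apply incl_injective q
  have h₂ : ∀ g, incl q (Function.invFun (incl q) (f g - liftCochain a g)) =
      f g - liftCochain a g := fun g => Function.invFun_eq (h₁ g)
  simp only [ContinuousMap.add_apply, d₁_apply, ContinuousMap.coe_mk, map_add, map_sub, h₂, h,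
    incl_bocksteinCochain]
  abel

variable (q G) in
/-- The Bockstein homomorphism `β : H¹(G, ℤ/q) → H²(G, ℤ/q)`. -/
def bockstein : H1 G (ZMod q) →+ H2 G (ZMod q) :=
  AddMonoidHom.mk' (fun a => H2.mk (bocksteinCochain a)
    (d₂_eq_zero_of_incl (incl_bocksteinCochain a))) (fun a b => by
      rw [H2.mk_add_mk]
      refine mk_bocksteinCochain_eq (a + b) (f := liftCochain a + liftCochain b) ?_ ?_
      · intro g
        simp [proj_liftCochain]
      · intro x
        simp only [ContinuousMap.add_apply, map_add, incl_bocksteinCochain])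

/-- The Bockstein homomorphism is the connecting homomorphism: it may be computed with any
continuous lift `f` of `a` to `ℤ/q²` and any `c` whose image in `ℤ/q²` is the coboundary of `f`. -/
theorem bockstein_eq (a : H1 G (ZMod q)) {c : C(G × G, ZMod q)} {f : C(G, ZMod (q ^ 2))}
    (hf : ∀ g, proj q (f g) = a.1 g) (h : ∀ x, incl q (c x) = d₁ G (ZMod (q ^ 2)) f x) :
    bockstein q G a = H2.mk c (d₂_eq_zero_of_incl h) :=
  mk_bocksteinCochain_eq a hf h

end Bockstein

/-! ### The descending `q`-central sequence -/

section DescendingCentral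

variable (q : ℕ) (G : Type*) [Group G] [TopologicalSpace G] [IsTopologicalGroup G]

/-- The descending `q`-central sequence `G⁽ⁱ⁾` of a topological group, for `i = 1, 2, 3, …`:
`G⁽¹⁾ = G`, and `G⁽ⁱ⁺¹⁾` is the closed subgroup topologically generated by all powers `h ^ q` and
all commutators `h⁻¹ g⁻¹ h g` with `h ∈ G⁽ⁱ⁾` and `g ∈ G`. (The value at `i = 0` is not used.) -/
def qCentral : ℕ → Subgroup G
  | 0 => ⊤
  | 1 => ⊤
  | i + 2 => (Subgroup.closure ({x | ∃ h ∈ qCentral (i + 1), x = h ^ q} ∪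
      {x | ∃ h ∈ qCentral (i + 1), ∃ g : G, x = h⁻¹ * g⁻¹ * h * g})).topologicalClosure

instance qCentral_normal : ∀ i, (qCentral q G i).Normal
  | 0 => by rw [qCentral]; infer_instance
  | 1 => by rw [qCentral]; infer_instance
  | i + 2 => by
    have ih := qCentral_normal (i + 1)
    rw [qCentral]
    refine @Subgroup.is_normal_topologicalClosure _ _ _ _ _ ⟨fun x hx g => ?_⟩
    induction hx using Subgroup.closure_induction with
    | mem x hx =>
      refine Subgroup.subset_closure ?_
      rcases hx with ⟨h, hh, rfl⟩ | ⟨h, hh, k, rfl⟩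
      · exact Or.inl ⟨g * h * g⁻¹, ih.conj_mem h hh g, by rw [conj_pow]⟩
      · exact Or.inr ⟨g * h * g⁻¹, ih.conj_mem h hh g, g * k * g⁻¹, by group⟩
    | one => simp
    | mul x y _ _ hx hy =>
      have e : g * (x * y) * g⁻¹ = g * x * g⁻¹ * (g * y * g⁻¹) := by group
      rw [e]
      exact mul_mem hx hy
    | inv x _ hx =>
      have e : g * x⁻¹ * g⁻¹ = (g * x * g⁻¹)⁻¹ := by group
      rw [e]
      exact inv_mem hx

/-- The quotient `G^{[i]} = G / G⁽ⁱ⁾`, with its quotient topology. -/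
abbrev QuotCentral (i : ℕ) : Type _ := G ⧸ qCentral q G i

end DescendingCentral

/-- The absolute Galois group `Gal(F_sep / F)` with the Krull topology. -/
abbrev AbsGal (F : Type*) [Field F] : Type _ := Gal(SeparableClosure F/F)

end GaloisQuotient

end

/-! Write q = p^d and let G be either Galois group. By Hilbert 90 and extraction of p-power roots,
every class in H¹(G) killed by p is divisible by p^(d-1) (`H1.exists_eq_pow_smul_of_smul_eq_zero`;
the second group inherits this through φ₁). Hence H¹ is free over ℤ/q, and a basis defines π : G →
(ℤ/q)^I, surjective with kernel G⁽²⁾. A basis for the first group is carried to the second by φ₁, so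
both groups map onto the same (ℤ/q)^I.

G^{[3]} is then recovered from the continuous functions f : G → ℤ/q whose coboundary is pulled back
along π from a cochain z on (ℤ/q)^I. By duality they separate points exactly modulo G⁽³⁾
(`IsFrattini.forall_isInflation_iff`), and f(xy) = f(x) + f(y) - z(πx, πy) encodes the
multiplication. Such a z is a cocycle, hence up to a coboundary a finite combination of cup products
and Bocksteins of the coordinates; its inflation is trivial iff the corresponding relation holds in
H²(G). As φ₁ and φ₂ respect these relations, the same z occur for both groups
(`exists_isInflation_iff`).

Each f is determined by z only up to a homomorphism, so the functions on the two groups must be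
paired coherently. The divisibility property makes Hom(G, ℤ/q) an injective ℤ/q-module, which yields
a module T of pairs that is the graph of a bijection (`exists_isMatching`). Evaluation on T embeds
both quotients in (ℤ/q)^T; compactness and duality show that the images agree, and the resulting
homeomorphism is multiplicative. -/

noncomputable section

namespace GaloisQuotient

/-! ### Modules over ℤ/p^d: injectivity and freeness from divisibility of p-torsion -/

section TorsionModules

variable {p d : ℕ} [Fact p.Prime]

omit [Fact p.Prime] in
theorem exists_eq_pow_smul_of_pow_smul_eq_zero {H : Type*} [AddCommGroup H]
    (hH : ∀ h : H, p • h = 0 → ∃ h' : H, h = p ^ (d - 1) • h') (i : ℕ) (hi : i ≤ d) (h : H)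
    (h0 : p ^ i • h = 0) : ∃ h' : H, h = p ^ (d - i) • h' := by
  induction i generalizing h with
  | zero => exact ⟨0, by simpa using h0⟩
  | succ i ih =>
    obtain ⟨h', e⟩ := hH (p ^ i • h) (by rw [smul_smul, ← pow_succ', h0])
    -- Since p^i h = p^(d-1) h', the difference h - p^(d-i-1) h' is killed by p^i.
    obtain ⟨h'', e'⟩ := ih (by omega) (h - p ^ (d - (i + 1)) • h') (by
      rw [smul_sub, e, smul_smul, ← pow_add, sub_eq_zero]
      congr 2
      omega)
    refine ⟨h' + p • h'', ?_⟩
    rw [smul_add, smul_smul, ← pow_succ, show d - (i + 1) + 1 = d - i by omega, ← e']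
    abel

theorem zmod_pow_torsion (h : ZMod (p ^ d)) (h0 : p • h = 0) :
    ∃ h' : ZMod (p ^ d), h = p ^ (d - 1) • h' := by
  obtain ⟨n, rfl⟩ := ZMod.intCast_surjective h
  have hp : 0 < p := (Fact.out : p.Prime).pos
  rcases d with _ | d
  · exact ⟨0, Subsingleton.elim (α := ZMod 1) _ _⟩
  · have h1 : ((p * n : ℤ) : ZMod (p ^ (d + 1))) = 0 := by
      rw [← h0]; simp
    rw [ZMod.intCast_zmod_eq_zero_iff_dvd] at h1
    push_cast at h1
    rw [pow_succ'] at h1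
    obtain ⟨m, hm⟩ := Int.dvd_of_mul_dvd_mul_left (by exact_mod_cast hp.ne') h1
    exact ⟨(m : ZMod _), by simp [hm]⟩

theorem ideal_zmod_pow_eq_span (I : Ideal (ZMod (p ^ d))) :
    ∃ i ≤ d, I = Ideal.span {((p ^ i : ℕ) : ZMod (p ^ d))} := by
  let f := Int.castRingHom (ZMod (p ^ d))
  have hf : Function.Surjective f := ZMod.intCast_surjective
  obtain ⟨g, hg⟩ := (IsPrincipalIdealRing.principal (I.comap f)).principal
  have hq : ((p ^ d : ℕ) : ℤ) ∈ I.comap f := by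
    rw [Ideal.mem_comap, map_natCast, ZMod.natCast_self]
    exact I.zero_mem
  rw [hg, Submodule.mem_span_singleton] at hq
  obtain ⟨a, ha⟩ := hq
  have hd : g.natAbs ∣ p ^ d := Int.natCast_dvd_natCast.1
    (Int.natAbs_dvd.2 ⟨a, by rw [← ha, smul_eq_mul, mul_comm]⟩)
  obtain ⟨i, hi, e⟩ := (Nat.dvd_prime_pow Fact.out).1 hd
  refine ⟨i, hi, ?_⟩
  rw [← Ideal.map_comap_of_surjective f hf I, hg, ← e]
  change Ideal.map f (Ideal.span {g}) = _
  rw [← Int.span_natAbs, Ideal.map_span, Set.image_singleton]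
  simp

/-- Every ideal is generated by some p^i. The image y of p^i under a map to H is killed by p^(d-i),
so y = p^i h', and 1 ↦ h' extends the map. -/
theorem baer_of_torsion {H : Type*} [AddCommGroup H] [Module (ZMod (p ^ d)) H]
    (hH : ∀ h : H, p • h = 0 → ∃ h' : H, h = p ^ (d - 1) • h') : Module.Baer (ZMod (p ^ d)) H := by
  intro I g
  obtain ⟨i, hi, rfl⟩ := ideal_zmod_pow_eq_span I
  set y := g ⟨_, Ideal.mem_span_singleton_self _⟩ with hy
  have hy0 : p ^ (d - i) • y = 0 := by
    rw [hy, ← map_nsmul, ← map_zero g]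
    congr 1
    ext
    rw [SetLike.val_smul_of_tower, nsmul_eq_mul, ZeroMemClass.coe_zero, ← Nat.cast_mul, ← pow_add, Nat.sub_add_cancel hi, ZMod.natCast_self]
  obtain ⟨h', e⟩ := exists_eq_pow_smul_of_pow_smul_eq_zero hH (d - i) (by omega) y hy0
  rw [show d - (d - i) = i by omega] at e
  refine ⟨LinearMap.toSpanSingleton _ _ h', fun x hx => ?_⟩
  obtain ⟨r, rfl⟩ := Ideal.mem_span_singleton'.1 hx
  rw [LinearMap.toSpanSingleton_apply, mul_smul, Nat.cast_smul_eq_nsmul, ← e, hy, ← map_smul]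
  rfl

/-- The cyclic module generated by m is (ℤ/q)/(p^i) with i > 0. Sending m to p^(d-i) ≠ 0 is well
defined, and extends to M because ℤ/q is self-injective. -/
theorem exists_linearMap_apply_ne_zero {M : Type*} [AddCommGroup M] [Module (ZMod (p ^ d)) M]
    {m : M} (hm : m ≠ 0) : ∃ l : M →ₗ[ZMod (p ^ d)] ZMod (p ^ d), l m ≠ 0 := by
  let f := LinearMap.toSpanSingleton (ZMod (p ^ d)) M m
  obtain ⟨i, hi, e⟩ := ideal_zmod_pow_eq_span (LinearMap.ker f)
  have hp : p.Prime := Fact.out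
  have hi0 : i ≠ 0 := by
    rintro rfl
    have h1 : (1 : ZMod (p ^ d)) ∈ LinearMap.ker f := by
      rw [e]; simp
    exact hm (by simpa [f] using h1)
  let g : ZMod (p ^ d) →ₗ[ZMod (p ^ d)] ZMod (p ^ d) :=
    LinearMap.toSpanSingleton _ _ ((p ^ (d - i) : ℕ) : ZMod (p ^ d))
  have hg : LinearMap.ker f ≤ LinearMap.ker g := by
    rw [e, Ideal.span, Submodule.span_singleton_le_iff_mem, LinearMap.mem_ker]
    simp only [g, LinearMap.toSpanSingleton_apply, smul_eq_mul]
    rw [← Nat.cast_mul, ← pow_add, Nat.add_sub_cancel' hi, ZMod.natCast_self]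
  obtain ⟨l, hl⟩ := (baer_of_torsion (p := p) (d := d) zmod_pow_torsion).extension_property
    ((LinearMap.ker f).liftQ f le_rfl) (by
      rw [← LinearMap.ker_eq_bot]
      exact Submodule.ker_liftQ_eq_bot' _ _ rfl) ((LinearMap.ker f).liftQ g hg)
  refine ⟨l, fun h0 => ?_⟩
  have h1 := LinearMap.congr_fun hl (Submodule.Quotient.mk 1)
  simp only [LinearMap.comp_apply, Submodule.liftQ_apply] at h1
  simp only [f, g, LinearMap.toSpanSingleton_apply, one_smul, h0] at h1
  have h2 := (ZMod.natCast_eq_zero_iff _ _).1 h1.symm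
  have h3 := (Nat.pow_dvd_pow_iff_le_right hp.one_lt).1 h2
  omega

/-- Lifts of a basis of V = H/pH form a basis of H: they generate by Nakayama's argument, as p is
nilpotent, and are independent because coefficients of a relation can be divided by p repeatedly. -/
theorem nonempty_basis_of_torsion_of_quotient {H V : Type*} [AddCommGroup H]
    [Module (ZMod (p ^ d)) H] [AddCommGroup V] [Module (ZMod p) V] (π : H →+ V)
    (hπ : Function.Surjective π) (hker : ∀ h, π h = 0 → ∃ h', h = p • h')
    (hH : ∀ h : H, p • h = 0 → ∃ h' : H, h = p ^ (d - 1) • h') :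
    ∃ ι : Set V, Nonempty (Module.Basis ι (ZMod (p ^ d)) H) := by
  have hpd : ∀ h : H, p ^ d • h = 0 := fun h => by
    rw [← Nat.cast_smul_eq_nsmul (ZMod (p ^ d)), ZMod.natCast_self, zero_smul]
  have hpV : ∀ v : V, p • v = 0 := fun v => by
    rw [← Nat.cast_smul_eq_nsmul (ZMod p), ZMod.natCast_self, zero_smul]
  let b := Module.Basis.ofVectorSpace (ZMod p) V
  choose x hx using fun i => hπ (b i)
  refine ⟨_, ⟨Module.Basis.mk (v := x) ?_ ?_⟩⟩
  · have key : ∀ (s : Finset _) (k : ℕ), k ≤ d → ∀ n : _ → ℤ, ∑ i ∈ s, n i • x i = 0 →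
        ∀ i ∈ s, ((p ^ k : ℕ) : ℤ) ∣ n i := by
      intro s k
      induction k with
      | zero => simp
      | succ k ih =>
        intro hk n hn i hi
        have h1 := ih (by omega) n hn
        choose! m hm using h1
        -- After writing n = p^k m, the sum of the m i • x i is killed by p^k, hence divisible by
        -- p^(d-k). As k < d, it dies in V, so p divides every m i.
        obtain ⟨h', e⟩ := exists_eq_pow_smul_of_pow_smul_eq_zero hH k (by omega)
          (∑ i ∈ s, m i • x i) (by
            rw [← hn, Finset.smul_sum]
            refine Finset.sum_congr rfl fun i hi => ?_
            rw [hm i hi, mul_smul, natCast_zsmul])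
        have h2 : ∑ i ∈ s, ((m i : ℤ) : ZMod p) • b i = 0 := by
          have h3 : π (∑ i ∈ s, m i • x i) = 0 := by
            rw [e, show d - k = (d - k - 1) + 1 by omega, pow_succ', mul_smul, map_nsmul, hpV]
          rw [← h3, map_sum]
          refine Finset.sum_congr rfl fun i _ => ?_
          rw [map_zsmul, hx, Int.cast_smul_eq_zsmul]
        have h4 := linearIndependent_iff'.1 b.linearIndependent s _ h2 i hi
        rw [ZMod.intCast_zmod_eq_zero_iff_dvd] at h4
        rw [hm i hi, pow_succ]
        push_cast
        exact mul_dvd_mul_left _ h4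
    rw [linearIndependent_iff']
    intro s g hg i hi
    choose n hn using fun i => ZMod.intCast_surjective (g i)
    rw [← hn, ZMod.intCast_zmod_eq_zero_iff_dvd]
    refine key s d le_rfl n ?_ i hi
    rw [← hg]
    refine Finset.sum_congr rfl fun i _ => ?_
    rw [← hn, Int.cast_smul_eq_zsmul]
  · set S := Submodule.span (ZMod (p ^ d)) (Set.range x) with hS
    have h1 : ∀ h : H, ∃ s ∈ S, ∃ h', h = s + p • h' := by
      intro h
      obtain ⟨l, hl⟩ := (Finsupp.mem_span_range_iff_exists_finsupp).1
        (b.mem_span (π h))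
      refine ⟨l.sum fun i a => a.val • x i, ?_, ?_⟩
      · exact Submodule.sum_mem _ fun i _ =>
          Submodule.smul_of_tower_mem _ _ (Submodule.subset_span ⟨i, rfl⟩)
      · have h2 : π (h - l.sum fun i a => a.val • x i) = 0 := by
          rw [map_sub, ← hl, sub_eq_zero, Finsupp.sum, Finsupp.sum, map_sum]
          refine Finset.sum_congr rfl fun i _ => ?_
          rw [map_nsmul, hx, ← Nat.cast_smul_eq_nsmul (ZMod p), ZMod.natCast_val,
            ZMod.cast_id]
        obtain ⟨h', e⟩ := hker _ h2
        exact ⟨h', by rw [← sub_eq_iff_eq_add', e]⟩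
    have h2 : ∀ (k : ℕ) (h : H), ∃ s ∈ S, ∃ h', h = s + p ^ k • h' := by
      intro k
      induction k with
      | zero => exact fun h => ⟨0, S.zero_mem, h, by simp⟩
      | succ k ih =>
        intro h
        obtain ⟨s, hs, h', rfl⟩ := ih h
        obtain ⟨s', hs', h'', rfl⟩ := h1 h'
        refine ⟨s + p ^ k • s', S.add_mem hs (Submodule.smul_of_tower_mem _ _ hs'), h'', ?_⟩
        rw [smul_add, smul_smul, pow_succ, add_assoc]
    intro h _
    obtain ⟨s, hs, h', rfl⟩ := h2 d h
    rw [hpd, add_zero]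
    exact hs

theorem nonempty_basis_of_torsion {H : Type*} [AddCommGroup H] [Module (ZMod (p ^ d)) H]
    (hH : ∀ h : H, p • h = 0 → ∃ h' : H, h = p ^ (d - 1) • h') :
    ∃ ι : Set (H ⧸ (nsmulAddMonoidHom (α := H) p).range),
      Nonempty (Module.Basis ι (ZMod (p ^ d)) H) := by
  let _ : Module (ZMod p) (H ⧸ (nsmulAddMonoidHom (α := H) p).range) :=
    AddCommGroup.zmodModule fun v => by
      obtain ⟨h, rfl⟩ := QuotientAddGroup.mk_surjective v
      rw [← QuotientAddGroup.mk_nsmul, QuotientAddGroup.eq_zero_iff]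
      exact ⟨h, rfl⟩
  refine nonempty_basis_of_torsion_of_quotient (QuotientAddGroup.mk' _)
    (QuotientAddGroup.mk'_surjective _) (fun h h0 => ?_) hH
  obtain ⟨h', e⟩ := (QuotientAddGroup.eq_zero_iff h).1 h0
  exact ⟨h', e.symm⟩

end TorsionModules

/-! ### Two-cocycles on finite free ℤ/q-modules -/

section AbelianCocycles

/-- The identity satisfied by inhomogeneous `2`-cocycles on an additive group. -/
def IsAddCocycle {A M : Type*} [Add A] [AddGroup M] (z : A → A → M) : Prop :=
  ∀ a b c, z b c - z (a + b) c + z a (b + c) - z a b = 0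

/-- The extension of an abelian group by an abelian group given by a symmetric cocycle. -/
@[ext] structure CocycleExt {A M : Type*} (z : A → A → M) where
  /-- the image in the quotient -/
  fst : A
  /-- the coordinate in the kernel -/
  snd : M

variable {A M : Type*} [AddCommGroup A] [AddCommGroup M] {z : A → A → M}

theorem IsAddCocycle.zero_left (hz : IsAddCocycle z) (a : A) : z 0 a = z 0 0 := by
  have := hz 0 0 a
  simp only [zero_add, sub_self] at this
  exact sub_eq_zero.1 this

/-- The group structure on the extension defined by a symmetric cocycle. -/
abbrev CocycleExt.addCommGroup (hz : IsAddCocycle z) (hs : ∀ a b, z a b = z b a) :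
    AddCommGroup (CocycleExt z) where
  toAdd := ⟨fun x y => ⟨x.fst + y.fst, x.snd + y.snd + z x.fst y.fst⟩⟩
  -- Cocycles are not normalized, which moves the neutral element away from (0, 0).
  toZero := ⟨⟨0, -z 0 0⟩⟩
  toNeg := ⟨fun x => ⟨-x.fst, -x.snd - z (-x.fst) x.fst - z 0 0⟩⟩
  add_assoc x y w := by
    refine CocycleExt.ext (add_assoc _ _ _) ?_
    have := hz x.fst y.fst w.fst
    change x.snd + y.snd + z x.fst y.fst + w.snd + z (x.fst + y.fst) w.fst =
      x.snd + (y.snd + w.snd + z y.fst w.fst) + z x.fst (y.fst + w.fst)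
    rw [← sub_eq_zero, ← neg_eq_zero, ← this]
    abel
  zero_add x := by
    refine CocycleExt.ext (zero_add _) ?_
    change -z 0 0 + x.snd + z 0 x.fst = x.snd
    rw [hz.zero_left x.fst]
    abel
  add_zero x := by
    refine CocycleExt.ext (add_zero _) ?_
    change x.snd + -z 0 0 + z x.fst 0 = x.snd
    rw [hs x.fst, hz.zero_left x.fst]
    abel
  neg_add_cancel x := by
    refine CocycleExt.ext (neg_add_cancel _) ?_
    change -x.snd - z (-x.fst) x.fst - z 0 0 + x.snd + z (-x.fst) x.fst = -z 0 0
    abel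
  add_comm x y := by
    refine CocycleExt.ext (add_comm _ _) ?_
    change x.snd + y.snd + z x.fst y.fst = y.snd + x.snd + z y.fst x.fst
    rw [hs]
    abel
  nsmul := @nsmulRec _ ⟨⟨0, -z 0 0⟩⟩ ⟨fun x y => ⟨x.fst + y.fst, x.snd + y.snd + z x.fst y.fst⟩⟩
  zsmul := @zsmulRec _ ⟨⟨0, -z 0 0⟩⟩ ⟨fun x y => ⟨x.fst + y.fst, x.snd + y.snd + z x.fst y.fst⟩⟩
    ⟨fun x => ⟨-x.fst, -x.snd - z (-x.fst) x.fst - z 0 0⟩⟩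
    (@nsmulRec _ ⟨⟨0, -z 0 0⟩⟩ ⟨fun x y => ⟨x.fst + y.fst, x.snd + y.snd + z x.fst y.fst⟩⟩)

theorem CocycleExt.nsmul_eq (hz : IsAddCocycle z) (hs : ∀ a b, z a b = z b a) (n : ℕ) (e : A) :
    letI := CocycleExt.addCommGroup hz hs
    n • (⟨e, 0⟩ : CocycleExt z) =
      ⟨n • e, -z 0 0 + ∑ k ∈ Finset.range n, z (k • e) e⟩ := by
  let _ := CocycleExt.addCommGroup hz hs
  induction n with
  | zero =>
    rw [zero_nsmul, zero_nsmul]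
    refine CocycleExt.ext rfl ?_
    change -z 0 0 = _
    simp
  | succ n ih =>
    rw [succ_nsmul, ih]
    refine CocycleExt.ext (succ_nsmul _ _).symm ?_
    change -z 0 0 + ∑ k ∈ Finset.range n, z (k • e) e + 0 + z (n • e) e = _
    rw [Finset.sum_range_succ, add_zero, add_assoc]

variable {q : ℕ} {J : Type*} [Fintype J] [DecidableEq J]

/-- A symmetric cocycle on a finite free `ℤ/q`-module is a coboundary if the `q`-th powers of the
lifts of the basis vectors are trivial. -/
theorem IsAddCocycle.exists_eq_coboundary {z : (J → ZMod q) → (J → ZMod q) → M}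
    (hz : IsAddCocycle z) (hs : ∀ a b, z a b = z b a)
    (h0 : ∀ j, ∑ k ∈ Finset.range q, z (k • Pi.single j 1) (Pi.single j 1) = 0) :
    ∃ f : (J → ZMod q) → M, ∀ a b, z a b = f b - f (a + b) + f a := by
  let _ := CocycleExt.addCommGroup hz hs
  let x : J → CocycleExt z := fun j => ⟨Pi.single j 1, 0⟩
  have hx : ∀ j, q • x j = 0 := fun j => by
    rw [CocycleExt.nsmul_eq hz hs, h0, add_zero]
    refine CocycleExt.ext ?_ rfl
    change q • (Pi.single j 1 : J → ZMod q) = 0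
    ext i
    simp
  -- The lifts x j of the basis vectors are killed by q, so they define a splitting of the
  -- extension; the second coordinate of the splitting gives the required cochain up to sign.
  let s : (J → ZMod q) →+ CocycleExt z := ∑ j, (ZMod.lift q
    ⟨zmultiplesHom _ (x j), by simpa using hx j⟩).comp (Pi.evalAddMonoidHom _ j)
  let π : CocycleExt z →+ (J → ZMod q) :=
    { toFun := CocycleExt.fst, map_zero' := rfl, map_add' := fun _ _ => rfl }
  have hπ : ∀ a, (s a).fst = a := by
    intro a
    change π (s a) = a
    simp only [s, AddMonoidHom.finsetSum_apply, map_sum, AddMonoidHom.comp_apply,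
      Pi.evalAddMonoidHom_apply]
    conv_rhs => rw [← Finset.univ_sum_single a]
    refine Finset.sum_congr rfl fun j _ => ?_
    obtain ⟨n, hn⟩ := ZMod.intCast_surjective (a j)
    rw [← hn, ZMod.lift_coe]
    change π (n • x j) = _
    rw [map_zsmul]
    change n • (Pi.single j 1 : J → ZMod q) = _
    rw [← Pi.single_smul]
    simp
  refine ⟨fun a => -(s a).snd, fun a b => ?_⟩
  have h1 : (s (a + b)).snd = (s a).snd + (s b).snd + z (s a).fst (s b).fst := by
    rw [map_add]
    rfl
  rw [hπ, hπ] at h1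
  beta_reduce
  rw [h1]
  abel

/-- The expression z a x - z x a is the commutator pairing of the extension. Its additivity is an
alternating combination of the cocycle identities at (a, b, x), (a, x, b) and (x, a, b). -/
theorem IsAddCocycle.antisymm_add_left (hz : IsAddCocycle z) (a b x : A) :
    z (a + b) x - z x (a + b) = (z a x - z x a) + (z b x - z x b) := by
  have h1 := hz a b x
  have h2 := hz a x b
  have h3 := hz x a b
  rw [add_comm x b] at h2
  rw [add_comm x a] at h3
  rw [← sub_eq_zero]
  have : z (a + b) x - z x (a + b) - ((z a x - z x a) + (z b x - z x b)) =
    -(z b x - z (a + b) x + z a (b + x) - z a b) + (z x b - z (a + x) b + z a (b + x) - z a x)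
    - (z a b - z (a + x) b + z x (a + b) - z x a) := by abel
  rw [this, h1, h2, h3]
  simp

variable (q) in
/-- The Bockstein cocycle on `ℤ/q`. -/
def bocksteinFun (u v : ZMod q) : ZMod q :=
  Function.invFun (incl q) (Function.surjInv (proj_surjective q) v -
    Function.surjInv (proj_surjective q) (u + v) + Function.surjInv (proj_surjective q) u)

theorem incl_bocksteinFun (u v : ZMod q) : incl q (bocksteinFun q u v) =
    Function.surjInv (proj_surjective q) v - Function.surjInv (proj_surjective q) (u + v) +
      Function.surjInv (proj_surjective q) u := by
  refine Function.invFun_eq ((proj_eq_zero_iff q _).1 ?_)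
  simp [Function.surjInv_eq]

theorem bocksteinFun_comm (u v : ZMod q) : bocksteinFun q u v = bocksteinFun q v u := by
  rw [bocksteinFun, bocksteinFun, add_comm u v]
  congr 1
  abel

theorem natCast_mul_eq_incl (x : ZMod (q ^ 2)) : (q : ZMod (q ^ 2)) * x = incl q (proj q x) := by
  obtain ⟨n, rfl⟩ := ZMod.intCast_surjective x
  rw [proj_intCast, incl_intCast]
  push_cast
  ring

section

variable [NeZero q]

theorem isAddCocycle_bocksteinFun : IsAddCocycle (bocksteinFun q) := by
  intro a b c
  apply incl_injective q
  simp only [map_sub, map_add, incl_bocksteinFun, map_zero, add_assoc a b c]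
  abel

/-- In the extension ℤ/q², q times a lift of 1 is the image of 1 in the kernel. The sum telescopes
because lifts are indexed by classes modulo q, so the two end terms cancel. -/
theorem sum_bocksteinFun : ∑ k ∈ Finset.range q, bocksteinFun q (k • 1) 1 = 1 := by
  apply incl_injective q
  rw [map_sum]
  simp only [incl_bocksteinFun]
  have h1 : ∀ k : ℕ, Function.surjInv (proj_surjective q) 1 -
      Function.surjInv (proj_surjective q) (k • 1 + 1) +
      Function.surjInv (proj_surjective q) (k • 1) =
      Function.surjInv (proj_surjective q) 1 - (Function.surjInv (proj_surjective q) ((k + 1) • 1)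
        - Function.surjInv (proj_surjective q) (k • 1)) := by
    intro k
    rw [succ_nsmul]
    abel
  simp only [h1]
  rw [Finset.sum_sub_distrib, Finset.sum_range_sub
    (fun k => Function.surjInv (proj_surjective q) (k • 1))]
  simp [natCast_mul_eq_incl, Function.surjInv_eq]

end

theorem IsAddCocycle.sub {z z' : A → A → M} (hz : IsAddCocycle z) (hz' : IsAddCocycle z') :
    IsAddCocycle fun a b => z a b - z' a b := by
  intro a b c
  have h := congrArg₂ (· - ·) (hz a b c) (hz' a b c)
  simp only [sub_zero] at h
  rw [← h]
  beta_reduce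
  abel

omit [Fintype J] [DecidableEq J] in
theorem isAddCocycle_bilin (B : (J → ZMod q) →ₗ[ZMod q] (J → ZMod q) →ₗ[ZMod q] ZMod q) :
    IsAddCocycle fun a b => B a b := by
  intro a b c
  simp only [map_add, LinearMap.add_apply]
  ring

omit [DecidableEq J] in
theorem isAddCocycle_sum_bocksteinFun [NeZero q] (m : J → ZMod q) :
    IsAddCocycle fun a b : J → ZMod q => ∑ i, m i * bocksteinFun q (a i) (b i) := by
  intro a b c
  rw [← Finset.sum_sub_distrib, ← Finset.sum_add_distrib, ← Finset.sum_sub_distrib]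
  refine Finset.sum_eq_zero fun i _ => ?_
  rw [← mul_sub, ← mul_add, ← mul_sub]
  have := isAddCocycle_bocksteinFun (a i) (b i) (c i)
  simp only [Pi.add_apply]
  rw [this, mul_zero]

/-- Every `2`-cocycle of a finite free `ℤ/q`-module with values in `ℤ/q` is a combination of cup
products and Bocksteins up to a coboundary. -/
theorem IsAddCocycle.exists_eq_cup_add_bockstein [NeZero q]
    {z : (J → ZMod q) → (J → ZMod q) → ZMod q} (hz : IsAddCocycle z) :
    ∃ (c : J → J → ZMod q) (m : J → ZMod q) (f : (J → ZMod q) → ZMod q), ∀ a b,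
      z a b = ∑ i, ∑ j, c i j * (a i * b j) + ∑ i, m i * bocksteinFun q (a i) (b i) +
        (f b - f (a + b) + f a) := by
  let Z : (J → ZMod q) →+ (J → ZMod q) →+ ZMod q :=
    AddMonoidHom.mk' (fun a => AddMonoidHom.mk' (fun b => z a b - z b a) fun b b' => by
      have := hz.antisymm_add_left b b' a
      rw [← neg_sub, this]
      abel) fun a a' => by
        ext b
        simpa using hz.antisymm_add_left a a' _
  let e : J → J → ZMod q := fun i j => Z (Pi.single i 1) (Pi.single j 1)
  have hZ : ∀ a b, Z a b = ∑ i, ∑ j, e i j * (a i * b j) := by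
    intro a b
    have ha : a = ∑ i, (a i).val • Pi.single i 1 := by
      conv_lhs => rw [← Finset.univ_sum_single a]
      refine Finset.sum_congr rfl fun i _ => ?_
      rw [← Pi.single_smul]
      simp
    have hb : b = ∑ i, (b i).val • Pi.single i 1 := by
      conv_lhs => rw [← Finset.univ_sum_single b]
      refine Finset.sum_congr rfl fun i _ => ?_
      rw [← Pi.single_smul]
      simp
    conv_lhs => rw [ha, hb]
    simp only [map_sum, map_nsmul, AddMonoidHom.finsetSum_apply, AddMonoidHom.nsmul_apply]
    simp only [Finset.smul_sum]
    rw [Finset.sum_comm]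
    refine Finset.sum_congr rfl fun i _ => Finset.sum_congr rfl fun j _ => ?_
    simp only [nsmul_eq_mul, ZMod.natCast_val, ZMod.cast_id', id_eq, e]
    ring
  have he : ∀ i, e i i = 0 := fun i => sub_self _
  have he' : ∀ i j, e j i = -e i j := fun i j => (neg_sub _ _).symm
  obtain ⟨o⟩ : Nonempty (LinearOrder J) := by
    classical
    exact ⟨linearOrderOfSTO WellOrderingRel⟩
  -- The upper triangular half of the alternating form e is a bilinear form whose antisymmetrization
  -- is e, without division by 2. Subtracting it makes z symmetric.
  let c : J → J → ZMod q := fun i j => if i < j then e i j else 0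
  let B : (J → ZMod q) →ₗ[ZMod q] (J → ZMod q) →ₗ[ZMod q] ZMod q :=
    Matrix.toLinearMap₂' (ZMod q) (Matrix.of c)
  have hB : ∀ a b, B a b = ∑ i, ∑ j, c i j * (a i * b j) := by
    intro a b
    simp only [B, Matrix.toLinearMap₂'_apply, Matrix.of_apply, smul_eq_mul]
    refine Finset.sum_congr rfl fun i _ => Finset.sum_congr rfl fun j _ => ?_
    ring
  have hBZ : ∀ a b, B a b - B b a = z a b - z b a := by
    intro a b
    change _ = Z a b
    rw [hZ, hB, hB, Finset.sum_comm (f := fun i j => c i j * (b i * a j)),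
      ← Finset.sum_sub_distrib]
    refine Finset.sum_congr rfl fun i _ => ?_
    rw [← Finset.sum_sub_distrib]
    refine Finset.sum_congr rfl fun j _ => ?_
    simp only [c]
    rcases lt_trichotomy i j with h | rfl | h
    · rw [if_pos h, if_neg h.not_gt]; ring
    · rw [if_neg (lt_irrefl _), he]; ring
    · rw [if_neg h.not_gt, if_pos h, he' j i]; ring
  -- m j is the obstruction to a lift of the j-th basis vector having order dividing q. By
  -- `sum_bocksteinFun`, subtracting m j times the j-th Bockstein cocycle removes it.
  let m : J → ZMod q := fun j => ∑ k ∈ Finset.range q,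
    (z (k • Pi.single j 1) (Pi.single j 1) - B (k • Pi.single j 1) (Pi.single j 1))
  obtain ⟨f, hf⟩ := ((hz.sub (isAddCocycle_bilin B)).sub
    (isAddCocycle_sum_bocksteinFun m)).exists_eq_coboundary (fun a b => by
      have h1 := hBZ a b
      simp only [bocksteinFun_comm (b _)]
      linear_combination -h1) (fun j => by
      rw [Finset.sum_sub_distrib, sub_eq_zero, Finset.sum_comm, Finset.sum_eq_single j]
      · rw [← Finset.mul_sum]
        simp only [Pi.smul_apply, Pi.single_eq_same]
        rw [sum_bocksteinFun, mul_one]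
      · intro i _ hi
        simp [hi]
      · simp)
  refine ⟨c, m, f, fun a b => ?_⟩
  rw [← hf, ← hB]
  ring

end AbelianCocycles

/-! ### Reduction of continuous cocycles to finitely many coordinates -/

section ContinuousCocycles

variable {I D E : Type*} [TopologicalSpace D] [DiscreteTopology D] [TopologicalSpace E]
  [DiscreteTopology E]

/-- A continuous function on a product of finite discrete spaces depends on finitely many
coordinates. -/
theorem exists_finset_forall_eq [Finite D] {F : (I → D) → E} (hF : Continuous F) :
    ∃ s : Finset I, ∀ a b, (∀ i ∈ s, a i = b i) → F a = F b := by
  have h1 : ∀ a : I → D, ∃ s : Finset I, ∀ b, (∀ i ∈ s, b i = a i) → F b = F a := by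
    intro a
    have h2 : F ⁻¹' {F a} ∈ nhds a :=
      ((isOpen_discrete {F a}).preimage hF).mem_nhds rfl
    rw [nhds_pi, Filter.mem_pi] at h2
    obtain ⟨s, hs, t, ht, hst⟩ := h2
    refine ⟨hs.toFinset, fun b hb => hst fun i hi => ?_⟩
    rw [hb i (hs.mem_toFinset.2 hi)]
    exact mem_of_mem_nhds (ht i)
  choose s hs using h1
  have ho : ∀ a : I → D, IsOpen (⋂ i ∈ s a, (fun b : I → D => b i) ⁻¹' {a i}) := fun a =>
    isOpen_biInter_finset fun i _ => (isOpen_discrete {a i}).preimage (continuous_apply i)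
  classical
  obtain ⟨t, ht⟩ := (isCompact_univ (X := I → D)).elim_finite_subcover _ ho
    fun a _ => Set.mem_iUnion.2 ⟨a, by simp⟩
  refine ⟨t.biUnion s, fun a b hab => ?_⟩
  obtain ⟨c, hc⟩ := Set.mem_iUnion.1 (ht (Set.mem_univ a))
  obtain ⟨hct, hc⟩ := Set.mem_iUnion.1 hc
  simp only [Set.mem_iInter, Set.mem_preimage, Set.mem_singleton_iff] at hc
  rw [hs c a hc, hs c b fun i hi =>
    (hab i (Finset.mem_biUnion.2 ⟨c, hct, hi⟩)).symm.trans (hc i hi)]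

/-- Every continuous `2`-cocycle of a product of copies of `ℤ/q` with values in `ℤ/q` is a
combination of cup products and Bocksteins up to a coboundary. -/
theorem IsAddCocycle.exists_eq_cup_add_bockstein_of_continuous {q : ℕ} [NeZero q]
    {z : (I → ZMod q) → (I → ZMod q) → ZMod q} (hz : IsAddCocycle z)
    (hc : Continuous fun x : (I → ZMod q) × (I → ZMod q) => z x.1 x.2) :
    ∃ (s : Finset I) (c : I → I → ZMod q) (m : I → ZMod q) (f : C(I → ZMod q, ZMod q)),
      ∀ a b, z a b = ∑ i ∈ s, ∑ j ∈ s, c i j * (a i * b j) +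
        ∑ i ∈ s, m i * bocksteinFun q (a i) (b i) + (f b - f (a + b) + f a) := by
  classical
  obtain ⟨s, hs⟩ := exists_finset_forall_eq (I := I) (D := ZMod q × ZMod q)
    (F := fun w => z (fun i => (w i).1) (fun i => (w i).2))
    (hc.comp (Continuous.prodMk (by fun_prop) (by fun_prop)))
  have hs' : ∀ a b a' b', (∀ i ∈ s, a i = a' i) → (∀ i ∈ s, b i = b' i) → z a b = z a' b' :=
    fun a b a' b' h h' => hs (fun i => (a i, b i)) (fun i => (a' i, b' i)) fun i hi =>
      Prod.ext (h i hi) (h' i hi)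
  -- Extension by zero is additive, so restricting z along it gives a cocycle on the finite product;
  -- z is recovered because it depends only on coordinates in s.
  let ε : (s → ZMod q) → I → ZMod q := fun a i => if h : i ∈ s then a ⟨i, h⟩ else 0
  have hε : ∀ a b, ε (a + b) = ε a + ε b := by
    intro a b
    ext i
    by_cases h : i ∈ s <;> simp [ε, h]
  have hε' : ∀ (a : I → ZMod q), ∀ i ∈ s, a i = ε (fun i => a i) i := by
    intro a i hi
    simp [ε, hi]
  obtain ⟨c, m, f, h⟩ := IsAddCocycle.exists_eq_cup_add_bockstein
    (z := fun a b : s → ZMod q => z (ε a) (ε b)) (fun a b c => by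
      simp only [hε]
      exact hz _ _ _)
  refine ⟨s, fun i j => if h : i ∈ s ∧ j ∈ s then c ⟨i, h.1⟩ ⟨j, h.2⟩ else 0,
    fun i => if h : i ∈ s then m ⟨i, h⟩ else 0,
    ⟨fun a => f fun i => a i, continuous_of_discreteTopology.comp (by fun_prop)⟩, fun a b => ?_⟩
  rw [hs' a b _ _ (hε' a) (hε' b)]
  have h' := h (fun i => a i) (fun i => b i)
  refine h'.trans ?_
  refine congrArg₂ _ (congrArg₂ _ ?_ ?_) rfl
  · rw [← Finset.sum_coe_sort s]
    refine Finset.sum_congr rfl fun i _ => ?_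
    rw [← Finset.sum_coe_sort s]
    refine Finset.sum_congr rfl fun j _ => ?_
    simp
  · rw [← Finset.sum_coe_sort s]
    refine Finset.sum_congr rfl fun i _ => ?_
    simp

end ContinuousCocycles

/-! ### Hilbert 90 and divisibility in H¹ of a Galois group -/

section Kummer

/-- The power `ζ ^ k` of an element with `ζ ^ q = 1` for an exponent `k` in `ℤ/q`. -/
def zmodPow {M : Type*} [Monoid M] {q : ℕ} (ζ : M) (k : ZMod q) : M := ζ ^ k.val

theorem zmodPow_natCast {M : Type*} [Monoid M] {q : ℕ} {ζ : M} (h : ζ ^ q = 1) (n : ℕ) :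
    zmodPow ζ (n : ZMod q) = ζ ^ n := by
  rw [zmodPow, ZMod.val_natCast, ← pow_eq_pow_mod n h]

theorem zmodPow_add {M : Type*} [Monoid M] {q : ℕ} [NeZero q] {ζ : M} (h : ζ ^ q = 1)
    (k l : ZMod q) : zmodPow ζ (k + l) = zmodPow ζ k * zmodPow ζ l := by
  obtain ⟨m, rfl⟩ := ZMod.natCast_zmod_surjective k
  obtain ⟨n, rfl⟩ := ZMod.natCast_zmod_surjective l
  rw [← Nat.cast_add, zmodPow_natCast h, zmodPow_natCast h, zmodPow_natCast h, pow_add]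

theorem zmodPow_nsmul {M : Type*} [Monoid M] {q : ℕ} [NeZero q] {ζ : M} (h : ζ ^ q = 1)
    (n : ℕ) (k : ZMod q) : zmodPow ζ (n • k) = zmodPow ζ k ^ n := by
  obtain ⟨m, rfl⟩ := ZMod.natCast_zmod_surjective k
  rw [nsmul_eq_mul, ← Nat.cast_mul, zmodPow_natCast h, zmodPow_natCast h, ← pow_mul, mul_comm]

theorem zmodPow_injective {M : Type*} [CommMonoid M] {q : ℕ} [NeZero q] {ζ : M}
    (h : IsPrimitiveRoot ζ q) : Function.Injective (zmodPow (q := q) ζ) := fun k l e =>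
  ZMod.val_injective q (h.pow_inj (ZMod.val_lt k) (ZMod.val_lt l) e)

theorem zmodPow_neg_add {M : Type*} [Monoid M] {q : ℕ} [NeZero q] {ζ : M} (h : ζ ^ q = 1)
    (k l : ZMod q) : zmodPow ζ (-k) = zmodPow ζ (-(k + l)) * zmodPow ζ l := by
  rw [← zmodPow_add h]
  congr 1
  ring

variable {F : Type*} [Field F] {q : ℕ} [NeZero q]

omit [NeZero q] in
theorem H1.map_one (χ : H1 (AbsGal F) (ZMod q)) : χ.1 1 = 0 := by
  simpa using H1.map_mul χ 1 1

omit [NeZero q] in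
theorem H1.map_inv (χ : H1 (AbsGal F) (ZMod q)) (σ : AbsGal F) : χ.1 σ⁻¹ = -χ.1 σ := by
  rw [eq_neg_iff_add_eq_zero, ← H1.map_mul, inv_mul_cancel, H1.map_one]

/-- Hilbert's Theorem 90 for the cocycle `σ ↦ ζ ^ χ(σ)`. -/
theorem exists_apply_eq_zmodPow_mul {ζ : F} (hζ : ζ ^ q = 1) (χ : H1 (AbsGal F) (ZMod q)) :
    ∃ y : SeparableClosure F, y ≠ 0 ∧
      ∀ σ : AbsGal F, σ y = algebraMap F _ (zmodPow ζ (χ.1 σ)) * y := by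
  classical
  let N : ClosedSubgroup (AbsGal F) :=
    { carrier := χ.1 ⁻¹' {0}
      one_mem' := H1.map_one χ
      mul_mem' := fun {a b} ha hb => by
        change χ.1 (a * b) = 0
        rw [H1.map_mul, show χ.1 a = 0 from ha, show χ.1 b = 0 from hb, add_zero]
      inv_mem' := fun {a} ha => by
        change χ.1 a⁻¹ = 0
        rw [H1.map_inv, show χ.1 a = 0 from ha, neg_zero]
      isClosed' := (isClosed_discrete {(0 : ZMod q)}).preimage χ.1.continuous }
  let L := IntermediateField.fixedField N.toSubgroup
  have hL : L.fixingSubgroup = N.toSubgroup := InfiniteGalois.fixingSubgroup_fixedField N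
  have hfix : ∀ σ τ : AbsGal F, χ.1 σ = χ.1 τ → ∀ x ∈ L, σ x = τ x := by
    intro σ τ h x hx
    have h1 : τ⁻¹ * σ ∈ L.fixingSubgroup := by
      rw [hL]
      change χ.1 (τ⁻¹ * σ) = 0
      rw [H1.map_mul, H1.map_inv, h, neg_add_cancel]
    have h2 := (IntermediateField.mem_fixingSubgroup_iff _ _).1 h1 x hx
    have h3 := congrArg τ h2
    rwa [AlgEquiv.mul_apply, ← AlgEquiv.mul_apply τ, mul_inv_cancel, AlgEquiv.one_apply] at h3
  let R : AddSubgroup (ZMod q) :=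
    { carrier := Set.range χ.1
      zero_mem' := ⟨1, H1.map_one χ⟩
      add_mem' := by
        rintro _ _ ⟨a, rfl⟩ ⟨b, rfl⟩
        exact ⟨a * b, H1.map_mul χ a b⟩
      neg_mem' := by
        rintro _ ⟨a, rfl⟩
        exact ⟨a⁻¹, H1.map_inv χ a⟩ }
  have hR : ∀ k : R, ∃ σ, χ.1 σ = k := fun k => k.2
  choose τ hτ using hR
  let g : R → (L →* SeparableClosure F) := fun k =>
    ((τ k : SeparableClosure F →ₐ[F] SeparableClosure F) :
      SeparableClosure F →* SeparableClosure F).comp (L.val : L →* SeparableClosure F)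
  have hg : ∀ k (x : L), g k x = τ k x := fun _ _ => rfl
  have hinj : Function.Injective g := by
    intro k l h
    have h1 : (τ l)⁻¹ * τ k ∈ L.fixingSubgroup := by
      rw [IntermediateField.mem_fixingSubgroup_iff]
      intro x hx
      have h2 := DFunLike.congr_fun h ⟨x, hx⟩
      rw [hg, hg] at h2
      change τ k x = τ l x at h2
      rw [AlgEquiv.mul_apply, h2, ← AlgEquiv.mul_apply, inv_mul_cancel, AlgEquiv.one_apply]
    rw [hL] at h1
    have h3 : χ.1 ((τ l)⁻¹ * τ k) = 0 := h1
    rw [H1.map_mul, H1.map_inv, hτ, hτ, neg_add_eq_zero] at h3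
    exact Subtype.ext h3.symm
  have hli := (linearIndependent_monoidHom L (SeparableClosure F)).comp g hinj
  rw [Fintype.linearIndependent_iff] at hli
  -- Some Lagrange resolvent is nonzero, by Dedekind's independence of the embeddings τ k of the
  -- fixed field L of ker χ, indexed by the finite image of χ.
  obtain ⟨x, hx⟩ : ∃ x : L, ∑ k : R, algebraMap F (SeparableClosure F)
      (zmodPow ζ (-(k : ZMod q))) * τ k x ≠ 0 := by
    by_contra! hcon
    have := hli (fun k => algebraMap F _ (zmodPow ζ (-(k : ZMod q)))) (by
      funext x
      rw [Finset.sum_apply]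
      exact hcon x) 0
    simp [zmodPow] at this
  refine ⟨_, hx, fun σ => ?_⟩
  rw [map_sum, Finset.mul_sum]
  -- On L, σ ∘ τ k agrees with τ (k + χ σ), so applying σ shifts the index of summation.
  refine Fintype.sum_equiv (Equiv.addRight (⟨χ.1 σ, σ, rfl⟩ : R)) _ _ fun k => ?_
  rw [map_mul, AlgEquiv.commutes, Equiv.coe_addRight, ← AlgEquiv.mul_apply,
    hfix (σ * τ k) (τ (k + ⟨χ.1 σ, σ, rfl⟩)) (by
      rw [H1.map_mul, hτ, hτ, add_comm]
      rfl) x x.2, zmodPow_neg_add hζ _ (χ.1 σ), map_mul]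
  change _ = _ * (algebraMap F _ (zmodPow ζ (-((k : ZMod q) + χ.1 σ))) * _)
  ring

/-- Choose y with σy = ζ^χ(σ) y and w with w^(p^(d-1)) = y. Then (σw/w)^q = ζ^(pχ(σ)) = 1, so σw =
ζ^ψ(σ) w for a character ψ, and taking p^(d-1)-th powers gives χ = p^(d-1) ψ. -/
theorem H1.exists_eq_pow_smul_of_smul_eq_zero {p d : ℕ} [Fact p.Prime] (hd : 1 ≤ d) {ζ : F}
    (hζ : IsPrimitiveRoot ζ (p ^ d)) (χ : H1 (AbsGal F) (ZMod (p ^ d))) (hχ : p • χ = 0) :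
    ∃ ψ : H1 (AbsGal F) (ZMod (p ^ d)), χ = p ^ (d - 1) • ψ := by
  have hp : p.Prime := Fact.out
  obtain ⟨y, hy0, hy⟩ := exists_apply_eq_zmodPow_mul hζ.pow_eq_one χ
  -- A primitive q-th root of unity forces p to be invertible in F, so w can be found in the
  -- separable closure.
  have hne : NeZero ((p ^ d : ℕ) : F) := hζ.neZero'
  have hpF : (p : F) ≠ 0 := fun h => hne.out (by
    rw [Nat.cast_pow, h, zero_pow (by omega)])
  have : NeZero ((p ^ (d - 1) : ℕ) : SeparableClosure F) := ⟨by
    rw [← map_natCast (algebraMap F (SeparableClosure F)), Ne, map_eq_zero, Nat.cast_pow]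
    exact pow_ne_zero _ hpF⟩
  obtain ⟨w, hw⟩ := IsSepClosed.exists_pow_nat_eq y (p ^ (d - 1))
  have hw0 : w ≠ 0 := by
    rintro rfl
    rw [zero_pow (pow_ne_zero _ hp.ne_zero)] at hw
    exact hy0 hw.symm
  set ι := algebraMap F (SeparableClosure F) with hι
  have hζ' : IsPrimitiveRoot (ι ζ) (p ^ d) := hζ.map_of_injective ι.injective
  have hιz : ∀ k : ZMod (p ^ d), ι (zmodPow ζ k) = zmodPow (ι ζ) k := fun k => map_pow _ _ _
  have h1 : ∀ σ : AbsGal F, ∃ k : ZMod (p ^ d), σ w = zmodPow (ι ζ) k * w := by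
    intro σ
    have h2 : (σ w / w) ^ (p ^ d) = 1 := by
      have e : p ^ d = p ^ (d - 1) * p := by
        rw [← pow_succ, Nat.sub_add_cancel hd]
      rw [e, pow_mul, div_pow, ← map_pow, hw, hy, mul_div_cancel_right₀ _ hy0, hιz,
        ← zmodPow_nsmul hζ'.pow_eq_one]
      have h3 : p • χ.1 σ = 0 := by
        have := DFunLike.congr_fun (congrArg Subtype.val hχ) σ
        simpa using this
      rw [h3]
      simp [zmodPow]
    obtain ⟨i, -, hi⟩ := hζ'.eq_pow_of_pow_eq_one h2
    exact ⟨i, by rw [zmodPow_natCast hζ'.pow_eq_one, hi, div_mul_cancel₀ _ hw0]⟩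
  choose ψ hψ using h1
  have hinj : ∀ k l : ZMod (p ^ d), zmodPow (ι ζ) k * w = zmodPow (ι ζ) l * w → k = l :=
    fun k l h => zmodPow_injective hζ' (mul_right_cancel₀ hw0 h)
  have hσ : ∀ (σ : AbsGal F) k, σ (zmodPow (ι ζ) k) = zmodPow (ι ζ) k := fun σ k => by
    rw [← hιz, hι, AlgEquiv.commutes]
  have hadd : ∀ σ τ, ψ (σ * τ) = ψ σ + ψ τ := by
    intro σ τ
    apply hinj
    rw [← hψ, AlgEquiv.mul_apply, hψ τ, _root_.map_mul, hσ, hψ σ, zmodPow_add hζ'.pow_eq_one]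
    ring
  have hcont : Continuous ψ := by
    have hfin : FiniteDimensional F (IntermediateField.adjoin F {w}) :=
      IntermediateField.adjoin.finiteDimensional (Algebra.IsIntegral.isIntegral w)
    have hopen := IntermediateField.fixingSubgroup_isOpen (IntermediateField.adjoin F {w})
    refine ((IsLocallyConstant.iff_exists_open ψ).2 fun σ => ?_).continuous
    refine ⟨_, hopen.preimage (continuous_const_mul σ⁻¹), ?_, fun τ hτ => ?_⟩
    · simp
    · have h2 := (IntermediateField.mem_fixingSubgroup_iff _ _).1 hτ w
        (IntermediateField.mem_adjoin_simple_self F w)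
      have h3 : ψ (σ⁻¹ * τ) = 0 := by
        apply hinj
        rw [← hψ, h2]
        simp [zmodPow]
      rw [← mul_inv_cancel_left σ τ, hadd, h3, add_zero]
  refine ⟨⟨⟨ψ, hcont⟩, AddMonoidHom.mem_ker.2 ?_⟩, ?_⟩
  · ext x
    simp [hadd]
  · ext σ
    change χ.1 σ = p ^ (d - 1) • ψ σ
    apply zmodPow_injective hζ'
    rw [zmodPow_nsmul hζ'.pow_eq_one]
    have h2 := congrArg (· ^ p ^ (d - 1)) (hψ σ)
    simp only [mul_pow, ← map_pow, hw] at h2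
    rw [hy] at h2
    rw [← hιz]
    rw [mul_right_cancel₀ hy0 h2]

end Kummer

/-! ### Duality for compact and profinite groups with values in ℤ/q -/

section Duality

variable {p d : ℕ} [Fact p.Prime]

/-- A family of continuous homomorphisms from a compact group to `ℤ/q` takes all families of values
which satisfy the linear relations of the family. -/
theorem exists_forall_apply_eq {S T : Type*} [Group S] [TopologicalSpace S] [CompactSpace S]
    (h : T → S → ZMod (p ^ d)) (hc : ∀ k, Continuous (h k))
    (hm : ∀ k x y, h k (x * y) = h k x + h k y) (v : T → ZMod (p ^ d))
    (hv : ∀ (s : Finset T) (n : T → ZMod (p ^ d)), (∀ x, ∑ k ∈ s, n k * h k x = 0) →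
      ∑ k ∈ s, n k * v k = 0) : ∃ x, ∀ k, h k x = v k := by
  classical
  have h1 : ∀ k, h k 1 = 0 := fun k => by simpa using hm k 1 1
  have hi : ∀ k x, h k x⁻¹ = -h k x := fun k x => by
    rw [eq_neg_iff_add_eq_zero, ← hm, inv_mul_cancel, h1]
  suffices hne : (⋂ k, h k ⁻¹' {v k}).Nonempty by
    obtain ⟨x, hx⟩ := hne
    exact ⟨x, fun k => Set.mem_iInter.1 hx k⟩
  refine CompactSpace.iInter_nonempty (fun k => (isClosed_discrete _).preimage (hc k)) fun s => ?_
  let B : AddSubgroup (s → ZMod (p ^ d)) :=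
    { carrier := Set.range fun x k => h k x
      zero_mem' := ⟨1, funext fun k => h1 k⟩
      add_mem' := by
        rintro _ _ ⟨a, rfl⟩ ⟨b, rfl⟩
        exact ⟨a * b, funext fun k => hm k a b⟩
      neg_mem' := by
        rintro _ ⟨a, rfl⟩
        exact ⟨a⁻¹, funext fun k => hi k a⟩ }
  let B' := AddSubgroup.toZModSubmodule (p ^ d) B
  by_cases hB : (fun k : s => v k) ∈ B'
  · obtain ⟨x, hx⟩ := hB
    exact ⟨x, Set.mem_iInter₂.2 fun k hk => congrFun hx ⟨k, hk⟩⟩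
  · exfalso
    -- A functional that vanishes on the attained values but not on v has coefficients forming a
    -- linear relation, which contradicts `hv`.
    obtain ⟨l, hl⟩ := exists_linearMap_apply_ne_zero (p := p) (d := d)
      (m := B'.mkQ (fun k : s => v k)) (by simpa using hB)
    let l' := l ∘ₗ B'.mkQ
    have hl' : ∀ w : T → ZMod (p ^ d), l' (fun k => w k) =
        ∑ k ∈ s, (if hk : k ∈ s then l' (Pi.single ⟨k, hk⟩ 1) else 0) * w k := by
      intro w
      rw [LinearMap.pi_apply_eq_sum_univ l', ← Finset.sum_coe_sort s]
      refine Finset.sum_congr rfl fun k _ => ?_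
      rw [dif_pos k.2, smul_eq_mul, mul_comm]
      congr 2
      ext i
      simp [Pi.single_apply, eq_comm]
    refine hl ?_
    change l' _ = 0
    rw [hl']
    refine hv s _ fun x => ?_
    rw [← hl' fun k => h k x]
    change l (B'.mkQ _) = 0
    rw [show B'.mkQ (fun k => h k x) = 0 by
      rw [Submodule.mkQ_apply, Submodule.Quotient.mk_eq_zero]
      exact ⟨x, rfl⟩, map_zero]

theorem exists_addMonoidHom_apply_ne_zero {M : Type*} [AddCommGroup M]
    (hM : ∀ m : M, p ^ d • m = 0) {m : M} (hm : m ≠ 0) : ∃ l : M →+ ZMod (p ^ d), l m ≠ 0 := by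
  let _ := AddCommGroup.zmodModule hM
  obtain ⟨l, hl⟩ := exists_linearMap_apply_ne_zero (p := p) (d := d) hm
  exact ⟨l.toAddMonoidHom, hl⟩

theorem exists_additive_apply_ne_zero {Q : Type*} [Group Q] (S : Subgroup Q)
    (hcen : ∀ s ∈ S, ∀ x, s * x = x * s) (hpow : ∀ s ∈ S, s ^ (p ^ d) = 1) {g : Q} (hg : g ∈ S)
    (hg1 : g ≠ 1) : ∃ l : Q → ZMod (p ^ d), (∀ x ∈ S, ∀ y ∈ S, l (x * y) = l x + l y) ∧
      l g ≠ 0 := by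
  classical
  let _ : CommGroup S := { mul_comm := fun a b => Subtype.ext (hcen a a.2 b) }
  obtain ⟨l, hl⟩ := exists_addMonoidHom_apply_ne_zero (p := p) (d := d) (M := Additive S)
    (fun x => Additive.toMul.injective (Subtype.ext (hpow _ x.toMul.2)))
    (m := Additive.ofMul ⟨g, hg⟩)
    (fun h => hg1 (congrArg Subtype.val (congrArg Additive.toMul h)))
  refine ⟨fun x => if h : x ∈ S then l (Additive.ofMul ⟨x, h⟩) else 0, ?_, ?_⟩
  · intro x hx y hy
    simp only [dif_pos hx, dif_pos hy, dif_pos (mul_mem hx hy)]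
    rw [← map_add]
    rfl
  · simpa only [dif_pos hg] using hl

variable {G : Type*} [Group G] [TopologicalSpace G] [IsTopologicalGroup G] [CompactSpace G]
  [TotallyDisconnectedSpace G]

/-- If `S / T` is a central section of exponent `q` of a profinite group `G`, the elements of
`S \ T` are detected by continuous functions on `G` which are additive along `S` and vanish
on `T`. -/
theorem exists_continuousMap_apply_ne_zero (S T : Subgroup G) [T.Normal]
    (hT : IsClosed (T : Set G)) (hcomm : ∀ s ∈ S, ∀ g : G, s⁻¹ * g⁻¹ * s * g ∈ T)
    (hpow : ∀ s ∈ S, s ^ (p ^ d) ∈ T) {g : G} (hgS : g ∈ S) (hgT : g ∉ T) :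
    ∃ f : C(G, ZMod (p ^ d)), (∀ x, ∀ s ∈ S, f (x * s) = f x + f s) ∧
      (∀ t ∈ T, f t = 0) ∧ f g ≠ 0 := by
  classical
  -- U is so small that gU misses T. Thus g survives in the discrete quotient by V = TU.
  obtain ⟨U, hU⟩ := ProfiniteGrp.exist_openNormalSubgroup_sub_open_nhds_of_one
    (U := (fun u => g * u) ⁻¹' (T : Set G)ᶜ) (hT.isOpen_compl.preimage (continuous_const_mul g))
    (by simpa using hgT)
  let V : Subgroup G := T ⊔ U.toSubgroup
  have hV : IsOpen (V : Set G) := Subgroup.isOpen_mono le_sup_right U.isOpen'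
  have hTV : T ≤ V := le_sup_left
  have hgV : g ∉ V := by
    intro h
    obtain ⟨t, ht, u, hu, e⟩ := Subgroup.mem_sup_of_normal_right.1 h
    refine hU (U.toSubgroup.inv_mem hu) ?_
    change g * u⁻¹ ∈ T
    rwa [← e, mul_inv_cancel_right]
  have : DiscreteTopology (G ⧸ V) := QuotientGroup.discreteTopology hV
  let S' : Subgroup (G ⧸ V) := S.map (QuotientGroup.mk' V)
  have hcen : ∀ s ∈ S', ∀ x : G ⧸ V, s * x = x * s := by
    rintro _ ⟨s, hs, rfl⟩ x
    obtain ⟨x, rfl⟩ := QuotientGroup.mk_surjective x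
    refine (QuotientGroup.eq (s := V) (a := s * x) (b := x * s)).2 ?_
    have e : (s * x)⁻¹ * (x * s) = (s⁻¹ * x⁻¹ * s * x)⁻¹ := by group
    rw [e]
    exact hTV (T.inv_mem (hcomm s hs x))
  have hpow' : ∀ s ∈ S', s ^ (p ^ d) = 1 := by
    rintro _ ⟨s, hs, rfl⟩
    rw [← map_pow]
    exact (QuotientGroup.eq_one_iff _).2 (hTV (hpow s hs))
  have hgS' : (QuotientGroup.mk g : G ⧸ V) ∈ S' := ⟨g, hgS, rfl⟩
  obtain ⟨l', hl', hl⟩ := exists_additive_apply_ne_zero S' hcen hpow' hgS'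
    fun h => hgV ((QuotientGroup.eq_one_iff g).1 h)
  let t : G ⧸ V → G ⧸ V := fun x => (QuotientGroup.mk x : (G ⧸ V) ⧸ S').out
  have ht : ∀ x, ∀ s ∈ S', t (x * s) = t x := by
    intro x s hs
    simp only [t]
    rw [QuotientGroup.mk_mul_of_mem x hs]
  have ht' : ∀ x, (t x)⁻¹ * x ∈ S' := by
    intro x
    rw [← QuotientGroup.eq]
    exact Quotient.out_eq' _
  -- The functional l' on S' is spread over cosets using representatives t; subtracting the value at
  -- 1 makes f' agree with l' on S'.
  let f' : G ⧸ V → ZMod (p ^ d) := fun x => l' ((t x)⁻¹ * x) - l' ((t 1)⁻¹ * 1)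
  have hf1 : ∀ s ∈ S', f' s = l' s := by
    intro s hs
    simp only [f']
    rw [← one_mul s, ht 1 s hs, ← mul_assoc, hl' _ (ht' 1) s hs, one_mul]
    abel
  have hf2 : ∀ x, ∀ s ∈ S', f' (x * s) = f' x + f' s := by
    intro x s hs
    rw [hf1 s hs]
    simp only [f']
    rw [ht x s hs, ← mul_assoc, hl' _ (ht' x) s hs]
    abel
  refine ⟨⟨fun x => f' x, 
    (continuous_of_discreteTopology (f := f')).comp continuous_quotient_mk'⟩, ?_, ?_, ?_⟩
  · intro x s hs
    exact hf2 x s ⟨s, hs, rfl⟩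
  · intro x hx
    change f' x = 0
    rw [(QuotientGroup.eq_one_iff x).2 (hTV hx), hf1 1 S'.one_mem]
    simpa using hl' 1 S'.one_mem 1 S'.one_mem
  · change f' g ≠ 0
    rw [hf1 _ hgS']
    exact hl

end Duality

/-! ### The descending q-central sequence -/

section CentralSequence

variable {q : ℕ} {G : Type*} [Group G] [TopologicalSpace G] [IsTopologicalGroup G]

theorem isClosed_qCentral : ∀ i, IsClosed (qCentral q G i : Set G)
  | 0 => by rw [qCentral]; exact isClosed_univ
  | 1 => by rw [qCentral]; exact isClosed_univ
  | i + 2 => by rw [qCentral]; exact Subgroup.isClosed_topologicalClosure _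

theorem pow_mem_qCentral {i : ℕ} {h : G} (hh : h ∈ qCentral q G (i + 1)) :
    h ^ q ∈ qCentral q G (i + 2) := by
  rw [qCentral]
  exact Subgroup.le_topologicalClosure _ (Subgroup.subset_closure (Or.inl ⟨h, hh, rfl⟩))

theorem commutator_mem_qCentral {i : ℕ} {h : G} (hh : h ∈ qCentral q G (i + 1)) (g : G) :
    h⁻¹ * g⁻¹ * h * g ∈ qCentral q G (i + 2) := by
  rw [qCentral]
  exact Subgroup.le_topologicalClosure _ (Subgroup.subset_closure (Or.inr ⟨h, hh, g, rfl⟩))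

theorem qCentral_le {i : ℕ} {K : Subgroup G} (hK : IsClosed (K : Set G))
    (hpow : ∀ h ∈ qCentral q G (i + 1), h ^ q ∈ K)
    (hcomm : ∀ h ∈ qCentral q G (i + 1), ∀ g, h⁻¹ * g⁻¹ * h * g ∈ K) :
    qCentral q G (i + 2) ≤ K := by
  rw [qCentral]
  refine Subgroup.topologicalClosure_minimal _ ((Subgroup.closure_le _).2 ?_) hK
  rintro _ (⟨h, hh, rfl⟩ | ⟨h, hh, g, rfl⟩)
  · exact hpow h hh
  · exact hcomm h hh g

theorem qCentral_succ_le (i : ℕ) : qCentral q G (i + 2) ≤ qCentral q G (i + 1) := by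
  refine qCentral_le (isClosed_qCentral _) (fun h hh => pow_mem hh _) fun h hh g => ?_
  rw [mul_assoc, mul_assoc, ← mul_assoc g⁻¹]
  refine mul_mem (inv_mem hh) ?_
  simpa using (qCentral_normal q G (i + 1)).conj_mem h hh g⁻¹

/-- A continuous function which is additive along `G⁽ⁱ⁾` vanishes on `G⁽ⁱ⁺¹⁾`. -/
theorem apply_eq_zero_of_mem_qCentral {i : ℕ} (f : C(G, ZMod q))
    (hl : ∀ x, ∀ s ∈ qCentral q G (i + 1), f (x * s) = f x + f s)
    (hr : ∀ x, ∀ s ∈ qCentral q G (i + 1), f (s * x) = f s + f x) {g : G}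
    (hg : g ∈ qCentral q G (i + 2)) : f g = 0 := by
  have h1 : f 1 = 0 := by simpa using hl 1 1 (one_mem _)
  have hi : ∀ s ∈ qCentral q G (i + 1), f s⁻¹ = -f s := fun s hs => by
    rw [eq_neg_iff_add_eq_zero, ← hl _ s hs, inv_mul_cancel, h1]
  let K : Subgroup G :=
    { carrier := (qCentral q G (i + 1) : Set G) ∩ f ⁻¹' {0}
      one_mem' := ⟨one_mem _, h1⟩
      mul_mem' := fun {a b} ha hb => ⟨mul_mem ha.1 hb.1, by
        change f (a * b) = 0
        rw [hl _ _ hb.1, show f a = 0 from ha.2, show f b = 0 from hb.2, add_zero]⟩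
      inv_mem' := fun {a} ha => ⟨(qCentral q G (i + 1)).inv_mem ha.1, by
        change f a⁻¹ = 0
        rw [hi _ ha.1, show f a = 0 from ha.2, neg_zero]⟩ }
  have hK : IsClosed (K : Set G) :=
    (isClosed_qCentral (i + 1)).inter ((isClosed_discrete {(0 : ZMod q)}).preimage f.continuous)
  refine (qCentral_le (K := K) hK (fun h hh => ⟨pow_mem hh _, ?_⟩) (fun h hh g =>
    ⟨qCentral_succ_le i (commutator_mem_qCentral hh g), ?_⟩) hg).2
  · have h2 : ∀ n : ℕ, f (h ^ n) = n • f h := by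
      intro n
      induction n with
      | zero => simpa using h1
      | succ n ih => rw [pow_succ, hl _ _ hh, ih, succ_nsmul]
    change f (h ^ q) = 0
    rw [h2]
    simp
  · change f (h⁻¹ * g⁻¹ * h * g) = 0
    have h2 : g⁻¹ * h * g ∈ qCentral q G (i + 1) := by
      simpa using (qCentral_normal q G (i + 1)).conj_mem h hh g⁻¹
    -- Expanding f(hg) both ways, with hg = g(g⁻¹hg), shows that f is invariant under conjugation on
    -- G⁽ⁱ⁾.
    have h3 := hl g _ h2
    rw [show g * (g⁻¹ * h * g) = h * g by group, hr _ _ hh, add_comm] at h3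
    rw [show h⁻¹ * g⁻¹ * h * g = h⁻¹ * (g⁻¹ * h * g) by group, hl _ _ h2, hi _ hh,
      ← add_left_cancel h3, neg_add_cancel]

end CentralSequence

/-! ### Functions with inflated coboundary separate points modulo G⁽³⁾ -/

section Presentation

variable {I : Type*} {q : ℕ} {G : Type*} [Group G] [TopologicalSpace G]

variable (q) in
/-- `π` is a continuous homomorphism from `G` onto a product of copies of `ℤ/q` with
kernel `G⁽²⁾`. -/
structure IsFrattini [IsTopologicalGroup G] (π : C(G, I → ZMod q)) : Prop where
  map_mul : ∀ x y, π (x * y) = π x + π y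
  surjective : Function.Surjective π
  mem_iff : ∀ x, x ∈ qCentral q G 2 ↔ π x = 0

/-- The coboundary of the cochain `f` is the inflation of the cochain `z` along `π`. -/
def IsInflation (π : C(G, I → ZMod q)) (z : C((I → ZMod q) × (I → ZMod q), ZMod q))
    (f : C(G, ZMod q)) : Prop :=
  ∀ x y, f y - f (x * y) + f x = z (π x, π y)

variable [IsTopologicalGroup G] {π : C(G, I → ZMod q)}

theorem IsFrattini.map_one (hπ : IsFrattini q π) : π 1 = 0 := by
  simpa using hπ.map_mul 1 1

theorem IsFrattini.map_inv (hπ : IsFrattini q π) (x : G) : π x⁻¹ = -π x := by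
  rw [eq_neg_iff_add_eq_zero, ← hπ.map_mul, inv_mul_cancel, hπ.map_one]

theorem IsFrattini.inv_mul_mem_iff (hπ : IsFrattini q π) {x y : G} :
    x⁻¹ * y ∈ qCentral q G 2 ↔ π x = π y := by
  rw [hπ.mem_iff, hπ.map_mul, hπ.map_inv, neg_add_eq_zero]

section

variable {z : C((I → ZMod q) × (I → ZMod q), ZMod q)} {f : C(G, ZMod q)}

/-- The pairs (x, s) and (x, 1) have the same image under π, so the coboundary takes the same value
on both. -/
theorem IsInflation.apply_mul (hπ : IsFrattini q π) (hf : IsInflation π z f) (x : G) {s : G}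
    (hs : s ∈ qCentral q G 2) : f (x * s) = f x + f s - f 1 := by
  have h1 := hf x s
  have h2 := hf x 1
  rw [(hπ.mem_iff s).1 hs] at h1
  rw [hπ.map_one, ← h1, mul_one] at h2
  linear_combination h2

theorem IsInflation.mul_apply (hπ : IsFrattini q π) (hf : IsInflation π z f) (x : G) {s : G}
    (hs : s ∈ qCentral q G 2) : f (s * x) = f s + f x - f 1 := by
  have h1 := hf s x
  have h2 := hf 1 x
  rw [(hπ.mem_iff s).1 hs] at h1
  rw [hπ.map_one, ← h1, one_mul] at h2
  linear_combination h2

theorem IsInflation.apply_mul_of_mem (hπ : IsFrattini q π) (hf : IsInflation π z f) (x : G)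
    {s : G} (hs : s ∈ qCentral q G 3) : f (x * s) = f x := by
  have h1 : (f - ContinuousMap.const G (f 1)) s = 0 := by
    refine apply_eq_zero_of_mem_qCentral (i := 1) _ (fun x s hs => ?_) (fun x s hs => ?_) hs
    · simp only [ContinuousMap.sub_apply, ContinuousMap.const_apply, hf.apply_mul hπ x hs]
      ring
    · simp only [ContinuousMap.sub_apply, ContinuousMap.const_apply, hf.mul_apply hπ x hs]
      ring
  simp only [ContinuousMap.sub_apply, ContinuousMap.const_apply] at h1
  rw [hf.apply_mul hπ x (qCentral_succ_le 1 hs)]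
  linear_combination h1

end

theorem isInflation_comp (hπ : IsFrattini q π) (c : C(I → ZMod q, ZMod q)) :
    IsInflation π ⟨fun a => c a.2 - c (a.1 + a.2) + c a.1, by fun_prop⟩ (c.comp π) := by
  intro x y
  simp [hπ.map_mul]

variable [CompactSpace G]

theorem IsFrattini.exists_comp_eq (hπ : IsFrattini q π) (f : C(G, ZMod q))
    (hf : ∀ x, ∀ s ∈ qCentral q G 2, f (x * s) = f x) :
    ∃ c : C(I → ZMod q, ZMod q), c.comp π = f := by
  have hq : Topology.IsQuotientMap π :=
    Topology.IsQuotientMap.of_surjective_continuous hπ.surjective π.continuous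
  refine ⟨hq.lift f fun x y h => ?_, hq.lift_comp f _⟩
  rw [← hf x _ (hπ.inv_mul_mem_iff.2 h), mul_inv_cancel_left]

theorem IsFrattini.exists_comp_eq_of_additive (hπ : IsFrattini q π) (f : C(G, ZMod q))
    (hf : ∀ x y, f (x * y) = f x + f y) : ∃ c : C(I → ZMod q, ZMod q), c.comp π = f := by
  refine hπ.exists_comp_eq f fun x s hs => ?_
  rw [hf, apply_eq_zero_of_mem_qCentral (i := 0) f (fun _ _ _ => hf _ _) (fun _ _ _ => hf _ _) hs,
    add_zero]

/-- Duality for the central section G⁽²⁾/G⁽³⁾ gives f additive along G⁽²⁾, zero on G⁽³⁾ and nonzero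
at g. As commutators of G⁽²⁾ with G lie in G⁽³⁾, f is additive from both sides, and its coboundary
descends to cosets of G⁽²⁾. -/
theorem IsFrattini.exists_isInflation_apply_ne {p d : ℕ} [Fact p.Prime]
    [TotallyDisconnectedSpace G] {π : C(G, I → ZMod (p ^ d))} (hπ : IsFrattini (p ^ d) π) {g : G}
    (hg : g ∈ qCentral (p ^ d) G 2) (hg' : g ∉ qCentral (p ^ d) G 3) :
    ∃ f z, IsInflation π z f ∧ f g ≠ f 1 := by
  obtain ⟨f, hf, hf0, hfg⟩ := exists_continuousMap_apply_ne_zero (qCentral (p ^ d) G 2)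
    (qCentral (p ^ d) G 3) (isClosed_qCentral _) (fun s hs x => commutator_mem_qCentral hs x)
    (fun s hs => pow_mem_qCentral hs) hg hg'
  have hr : ∀ x, ∀ s ∈ qCentral (p ^ d) G 2, f (s * x) = f x + f s := by
    intro x s hs
    have h2 := commutator_mem_qCentral hs x
    have e : s * x = x * (s * (s⁻¹ * x⁻¹ * s * x)) := by group
    rw [e, hf x _ (mul_mem hs (qCentral_succ_le 1 h2)), hf s _ (qCentral_succ_le 1 h2), hf0 _ h2,
      add_zero]
  let P : C(G × G, (I → ZMod (p ^ d)) × (I → ZMod (p ^ d))) := π.prodMap π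
  have hP : Topology.IsQuotientMap P :=
    Topology.IsQuotientMap.of_surjective_continuous
      (hπ.surjective.prodMap hπ.surjective) P.continuous
  obtain ⟨z, hl⟩ : ∃ z : C(_, ZMod (p ^ d)), z.comp P = d₁ G (ZMod (p ^ d)) f := ⟨_, hP.lift_comp _ (by
    rintro ⟨x, y⟩ ⟨x', y'⟩ h
    obtain ⟨h1, h2⟩ := Prod.ext_iff.1 h
    replace h1 := hπ.inv_mul_mem_iff.2 h1
    replace h2 := hπ.inv_mul_mem_iff.2 h2
    obtain ⟨s, rfl⟩ : ∃ s, x' = x * s := ⟨x⁻¹ * x', by group⟩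
    obtain ⟨t, rfl⟩ : ∃ t, y' = y * t := ⟨y⁻¹ * y', by group⟩
    rw [inv_mul_cancel_left] at h1 h2
    have h3 : y⁻¹ * s * y ∈ qCentral (p ^ d) G 2 := by
      simpa using (qCentral_normal (p ^ d) G 2).conj_mem s h1 y⁻¹
    have h4 := hf y _ h3
    rw [show y * (y⁻¹ * s * y) = s * y by group, hr y s h1] at h4
    simp only [d₁_apply]
    rw [show x * s * (y * t) = x * y * (y⁻¹ * s * y) * t by group, hf y t h2,
      hf _ t h2,
      hf _ _ h3, hf x s h1]
    linear_combination -h4)⟩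
  refine ⟨f, z, fun x y => (DFunLike.congr_fun hl (x, y)).symm, ?_⟩
  rwa [hf0 1 (one_mem _)]

/-- The coordinates of π are themselves such functions and detect points modulo G⁽²⁾; the remaining
difference in G⁽²⁾ is detected modulo G⁽³⁾ by the preceding lemma. -/
theorem IsFrattini.forall_isInflation_iff {p d : ℕ} [Fact p.Prime]
    [TotallyDisconnectedSpace G] {π : C(G, I → ZMod (p ^ d))} (hπ : IsFrattini (p ^ d) π)
    {g g' : G} : (∀ f z, IsInflation π z f → f g = f g') ↔ g⁻¹ * g' ∈ qCentral (p ^ d) G 3 := by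
  constructor
  · intro h
    have h1 : π g = π g' := by
      ext i
      exact h _ _ (isInflation_comp hπ ⟨fun a => a i, by fun_prop⟩)
    have h2 := hπ.inv_mul_mem_iff.2 h1
    by_contra h3
    obtain ⟨f, z, hf, hne⟩ := hπ.exists_isInflation_apply_ne h2 h3
    have h4 := hf.apply_mul hπ g h2
    rw [mul_inv_cancel_left, ← h f z hf] at h4
    exact hne (by linear_combination -h4)
  · intro h f z hf
    rw [← hf.apply_mul_of_mem hπ g h, mul_inv_cancel_left]

end Presentation

/-! ### Matching the functions on two groups and reconstructing G^{[3]} -/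

section Reconstruction

variable {I : Type*} {p d : ℕ} [Fact p.Prime]
variable {G₁ : Type*} [Group G₁] [TopologicalSpace G₁] [IsTopologicalGroup G₁] [CompactSpace G₁]
variable {G₂ : Type*} [Group G₂] [TopologicalSpace G₂] [IsTopologicalGroup G₂] [CompactSpace G₂]

theorem isInflation_add {q : ℕ} {G : Type*} [Group G] [TopologicalSpace G] {π : C(G, I → ZMod q)}
    {z z' : C((I → ZMod q) × (I → ZMod q), ZMod q)} {f f' : C(G, ZMod q)} (h : IsInflation π z f)
    (h' : IsInflation π z' f') : IsInflation π (z + z') (f + f') := by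
  intro x y
  simp only [ContinuousMap.add_apply, ← h x y, ← h' x y]
  ring

theorem isInflation_smul {q : ℕ} {G : Type*} [Group G] [TopologicalSpace G]
    {π : C(G, I → ZMod q)} {z : C((I → ZMod q) × (I → ZMod q), ZMod q)} {f : C(G, ZMod q)}
    (h : IsInflation π z f) (r : ZMod q) : IsInflation π (r • z) (r • f) := by
  intro x y
  simp only [ContinuousMap.smul_apply, ← h x y, smul_eq_mul]
  ring

/-- The continuous homomorphisms to `ℤ/q`, as a submodule of the continuous functions. -/
def homSubmodule (q : ℕ) (G : Type*) [Group G] [TopologicalSpace G] :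
    Submodule (ZMod q) C(G, ZMod q) where
  carrier := {f | ∀ x y, f (x * y) = f x + f y}
  add_mem' := fun {f f'} h h' x y => by
    simp only [ContinuousMap.add_apply, h x y, h' x y]
    ring
  zero_mem' := fun x y => by simp
  smul_mem' := fun r f h x y => by
    simp only [ContinuousMap.smul_apply, h x y, smul_add]

/-- Pairs of cochains on two groups whose coboundaries are inflations of the same cochain. -/
def inflationPairs {q : ℕ} (π₁ : C(G₁, I → ZMod q)) (π₂ : C(G₂, I → ZMod q)) :
    Submodule (ZMod q) (C(G₁, ZMod q) × C(G₂, ZMod q)) where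
  carrier := {t | ∃ z, IsInflation π₁ z t.1 ∧ IsInflation π₂ z t.2}
  add_mem' := by
    rintro _ _ ⟨z, h1, h2⟩ ⟨z', h1', h2'⟩
    exact ⟨z + z', isInflation_add h1 h1', isInflation_add h2 h2'⟩
  zero_mem' := ⟨0, fun x y => by simp, fun x y => by simp⟩
  smul_mem' := by
    rintro r _ ⟨z, h1, h2⟩
    exact ⟨r • z, isInflation_smul h1 r, isInflation_smul h2 r⟩

/-- A module of pairs of cochains which matches the cochains on `G₁` whose coboundary is inflated
bijectively with those on `G₂`. -/
structure IsMatching {q : ℕ} (π₁ : C(G₁, I → ZMod q)) (π₂ : C(G₂, I → ZMod q))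
    (T : Submodule (ZMod q) (C(G₁, ZMod q) × C(G₂, ZMod q))) : Prop where
  le : T ≤ inflationPairs π₁ π₂
  comp_mem : ∀ c : C(I → ZMod q, ZMod q), (c.comp π₁, c.comp π₂) ∈ T
  exists_right : ∀ f₁ z, IsInflation π₁ z f₁ → ∃ f₂, (f₁, f₂) ∈ T
  exists_left : ∀ f₂ z, IsInflation π₂ z f₂ → ∃ f₁, (f₁, f₂) ∈ T
  eq_zero_right : ∀ f₂, ((0 : C(G₁, ZMod q)), f₂) ∈ T → f₂ = 0
  eq_zero_left : ∀ f₁, (f₁, (0 : C(G₂, ZMod q))) ∈ T → f₁ = 0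

omit [IsTopologicalGroup G₁] [CompactSpace G₁] [IsTopologicalGroup G₂] [CompactSpace G₂] in
theorem IsMatching.swap {q : ℕ} {π₁ : C(G₁, I → ZMod q)} {π₂ : C(G₂, I → ZMod q)}
    {T : Submodule (ZMod q) (C(G₁, ZMod q) × C(G₂, ZMod q))} (hT : IsMatching π₁ π₂ T) :
    IsMatching π₂ π₁ (T.comap (LinearEquiv.prodComm _ _ _ : _ ≃ₗ[ZMod q] _).toLinearMap) where
  le := fun t ht => by
    obtain ⟨z, h1, h2⟩ := hT.le ht
    exact ⟨z, h2, h1⟩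
  comp_mem := fun c => hT.comp_mem c
  exists_right := hT.exists_left
  exists_left := hT.exists_right
  eq_zero_right := hT.eq_zero_left
  eq_zero_left := hT.eq_zero_right

/-- Among all pairs, the second entry is ambiguous up to Hom(G₂, ℤ/q). By injectivity of this module
there is a retraction ρ onto it that kills the pairs (c ∘ π₁, c ∘ π₂); its kernel is T. -/
theorem exists_isMatching {π₁ : C(G₁, I → ZMod (p ^ d))} {π₂ : C(G₂, I → ZMod (p ^ d))}
    (h₁ : IsFrattini (p ^ d) π₁) (h₂ : IsFrattini (p ^ d) π₂)
    (hH : ∀ h ∈ homSubmodule (p ^ d) G₂, p • h = 0 →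
      ∃ h' ∈ homSubmodule (p ^ d) G₂, h = p ^ (d - 1) • h')
    (hz : ∀ z, (∃ f, IsInflation π₁ z f) ↔ ∃ f, IsInflation π₂ z f) :
    ∃ T, IsMatching π₁ π₂ T := by
  have hbaer : Module.Baer (ZMod (p ^ d)) (homSubmodule (p ^ d) G₂) :=
    baer_of_torsion fun h h0 => by
      obtain ⟨h', hm, e⟩ := hH h h.2 (congrArg Subtype.val h0)
      exact ⟨⟨h', hm⟩, Subtype.ext e⟩
  let X := inflationPairs π₁ π₂
  have hX : ∀ (h : homSubmodule (p ^ d) G₂) (c : C(I → ZMod (p ^ d), ZMod (p ^ d))),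
      (c.comp π₁, (h : C(G₂, ZMod (p ^ d))) + c.comp π₂) ∈ X := by
    intro h c
    refine ⟨_, isInflation_comp h₁ c, ?_⟩
    have h0 : IsInflation π₂ 0 h.1 := fun x y => by
      rw [h.2 x y]
      simp
    have := isInflation_add h0 (isInflation_comp h₂ c)
    rwa [zero_add] at this
  let i : (homSubmodule (p ^ d) G₂ × C(I → ZMod (p ^ d), ZMod (p ^ d))) →ₗ[ZMod (p ^ d)] X :=
    { toFun := fun t => ⟨_, hX t.1 t.2⟩
      map_add' := fun t t' => Subtype.ext (Prod.ext (by ext x; rfl) (by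
        ext x
        change (t.1.1 x + t'.1.1 x) + (t.2 (π₂ x) + t'.2 (π₂ x)) =
          (t.1.1 x + t.2 (π₂ x)) + (t'.1.1 x + t'.2 (π₂ x))
        abel))
      map_smul' := fun r t => Subtype.ext (Prod.ext (by ext x; rfl) (by
        ext x
        change r * t.1.1 x + r * t.2 (π₂ x) = r * (t.1.1 x + t.2 (π₂ x))
        ring)) }
  have hcomp : ∀ c : C(I → ZMod (p ^ d), ZMod (p ^ d)), c.comp π₁ = 0 → c = 0 := by
    intro c h
    ext a
    obtain ⟨x, rfl⟩ := h₁.surjective a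
    exact DFunLike.congr_fun h x
  have hi : Function.Injective i := by
    rw [injective_iff_map_eq_zero]
    rintro ⟨h, c⟩ h0
    obtain ⟨e1, e2⟩ := Prod.ext_iff.1 (congrArg Subtype.val h0)
    have hc := hcomp c e1
    subst hc
    refine Prod.ext (Subtype.ext ?_) rfl
    ext x
    simpa [i] using DFunLike.congr_fun e2 x
  -- ρ is prescribed by (c ∘ π₁, h + c ∘ π₂) ↦ h; this is consistent since π₁ is surjective and so c
  -- is determined by c ∘ π₁.
  obtain ⟨ρ, hρ⟩ := hbaer.extension_property i hi (LinearMap.fst _ _ _)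
  have hρ' : ∀ h c, ρ ⟨_, hX h c⟩ = h := fun h c => LinearMap.congr_fun hρ (h, c)
  let T := (LinearMap.ker ρ).map X.subtype
  have hT : ∀ t (ht : t ∈ X), ρ ⟨t, ht⟩ = 0 → t ∈ T := fun t ht h => ⟨⟨t, ht⟩, h, rfl⟩
  have hTX : ∀ t ∈ T, ∃ ht : t ∈ X, ρ ⟨t, ht⟩ = 0 := by
    rintro _ ⟨t, ht, rfl⟩
    exact ⟨t.2, ht⟩
  have hcompT : ∀ c : C(I → ZMod (p ^ d), ZMod (p ^ d)), (c.comp π₁, c.comp π₂) ∈ T := by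
    intro c
    have h0 := hX 0 c
    have e := hρ' 0 c
    simp only [ZeroMemClass.coe_zero, zero_add] at h0 e
    exact hT _ h0 e
  have hright : ∀ f₂, ((0 : C(G₁, ZMod (p ^ d))), f₂) ∈ T → f₂ = 0 := by
    intro f₂ hf
    obtain ⟨⟨z, hz1, hz2⟩, h0⟩ := hTX _ hf
    have hz0 : ∀ x y : G₂, z (π₂ x, π₂ y) = 0 := by
      intro x y
      obtain ⟨x', hx⟩ := h₁.surjective (π₂ x)
      obtain ⟨y', hy⟩ := h₁.surjective (π₂ y)
      rw [← hx, ← hy, ← hz1 x' y']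
      simp
    have hm : f₂ ∈ homSubmodule (p ^ d) G₂ := by
      intro x y
      have := hz2 x y
      rw [hz0] at this
      linear_combination -this
    have e := hρ' ⟨f₂, hm⟩ 0
    have e2 : (⟨_, hX ⟨f₂, hm⟩ 0⟩ : X) = ⟨(0, f₂), ⟨z, hz1, hz2⟩⟩ :=
      Subtype.ext (Prod.ext (by ext x; rfl) (by ext x; simp))
    rw [e2, h0] at e
    exact (congrArg Subtype.val e).symm
  refine ⟨T, ?_, hcompT, ?_, ?_, hright, ?_⟩
  · rintro t ht
    exact (hTX t ht).1
  · intro f₁ z hf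
    obtain ⟨f₂, hf₂⟩ := (hz z).1 ⟨f₁, hf⟩
    have hx : (f₁, f₂) ∈ X := ⟨z, hf, hf₂⟩
    let h := ρ ⟨_, hx⟩
    have hm : (f₁, f₂ - h.1) ∈ X := by
      have := X.sub_mem hx (hX h 0)
      simpa using this
    have e : (⟨(f₁, f₂), hx⟩ : X) - ⟨_, hX h 0⟩ = ⟨(f₁, f₂ - h.1), hm⟩ :=
      Subtype.ext (Prod.ext (by ext x; simp) (by ext x; simp))
    refine ⟨f₂ - h.1, hT _ hm ?_⟩
    rw [← e, map_sub, hρ', sub_self]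
  · intro f₂ z hf
    obtain ⟨f₁, hf₁⟩ := (hz z).2 ⟨f₂, hf⟩
    have hx : (f₁, f₂) ∈ X := ⟨z, hf₁, hf⟩
    let h := ρ ⟨_, hx⟩
    -- Here f₂ must not change. With h = c ∘ π₂, the pair (c ∘ π₁, 0) = (c ∘ π₁, -h + c ∘ π₂) has
    -- ρ-value -h and corrects f₁ alone.
    obtain ⟨c, hc⟩ := h₂.exists_comp_eq_of_additive h.1 h.2
    have hm : (f₁ + c.comp π₁, f₂) ∈ X := by
      have := X.add_mem hx (hX (-h) c)
      simpa [hc] using this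
    have e : (⟨(f₁, f₂), hx⟩ : X) + ⟨_, hX (-h) c⟩ = ⟨(f₁ + c.comp π₁, f₂), hm⟩ :=
      Subtype.ext (Prod.ext rfl (by simp [hc]))
    refine ⟨f₁ + c.comp π₁, hT _ hm ?_⟩
    rw [← e, map_add, hρ']
    simp [h]
  · intro f₁ hf
    obtain ⟨⟨z, hz1, hz2⟩, h0⟩ := hTX _ hf
    have hz0 : ∀ x y : G₁, z (π₁ x, π₁ y) = 0 := by
      intro x y
      obtain ⟨x', hx⟩ := h₂.surjective (π₁ x)
      obtain ⟨y', hy⟩ := h₂.surjective (π₁ y)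
      rw [← hx, ← hy, ← hz2 x' y']
      simp
    obtain ⟨c, rfl⟩ := h₁.exists_comp_eq_of_additive f₁ fun x y => by
      have := hz1 x y
      rw [hz0] at this
      linear_combination -this
    have hm := T.sub_mem (hcompT c) hf
    simp only [Prod.mk_sub_mk, sub_self, sub_zero] at hm
    have h2 := hright _ hm
    ext x
    obtain ⟨y, hy⟩ := h₂.surjective (π₁ x)
    have := DFunLike.congr_fun h2 y
    simpa [hy] using this

-- Choose g₀ over π₁ g₁ and correct it by s in G₂⁽²⁾, along which all second entries are additive up
-- to a constant. By duality such an s exists if the prescribed values respect all linear relations.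
omit [IsTopologicalGroup G₁] [CompactSpace G₁] in
theorem IsMatching.exists_apply_eq {π₁ : C(G₁, I → ZMod (p ^ d))}
    {π₂ : C(G₂, I → ZMod (p ^ d))} {T} (hT : IsMatching π₁ π₂ T)
    (h₂ : IsFrattini (p ^ d) π₂) (g₁ : G₁) :
    ∃ g₂, ∀ t ∈ T, t.1 g₁ = t.2 g₂ := by
  obtain ⟨g₀, h0⟩ := h₂.surjective (π₁ g₁)
  have : CompactSpace (qCentral (p ^ d) G₂ 2) :=
    isCompact_iff_compactSpace.1 (isClosed_qCentral 2).isCompact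
  obtain ⟨s, hs⟩ := exists_forall_apply_eq (S := qCentral (p ^ d) G₂ 2) (T := T)
    (fun t s => t.1.2 s - t.1.2 1) (fun t => by fun_prop) (fun t x y => by
      obtain ⟨z, -, hz⟩ := hT.le t.2
      rw [Subgroup.coe_mul, hz.apply_mul h₂ x y.2]
      ring) (fun t => t.1.1 g₁ - t.1.2 g₀) (fun s n hn => by
      let u : T := ∑ t ∈ s, n t • t
      have hu1 : ∀ x, u.1.1 x = ∑ t ∈ s, n t * t.1.1 x := by
        intro x
        simp [u, Prod.fst_sum, ContinuousMap.sum_apply]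
      have hu2 : ∀ x, u.1.2 x = ∑ t ∈ s, n t * t.1.2 x := by
        intro x
        simp [u, Prod.snd_sum, ContinuousMap.sum_apply]
      simp only [mul_sub, Finset.sum_sub_distrib, ← hu1, ← hu2] at hn ⊢
      obtain ⟨z, -, hz⟩ := hT.le u.2
      -- A relation says that u.2 is constant along cosets of G₂⁽²⁾, so u.2 = c ∘ π₂. Matching
      -- forces u.1 = c ∘ π₁, and the two values agree because π₂ g₀ = π₁ g₁.
      obtain ⟨c, hc⟩ := h₂.exists_comp_eq u.1.2 fun x s hs => by
        rw [hz.apply_mul h₂ x hs]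
        linear_combination hn ⟨s, hs⟩
      have hm := T.sub_mem u.2 (hT.comp_mem c)
      have e : u.1 - (c.comp π₁, c.comp π₂) = (u.1.1 - c.comp π₁, 0) :=
        Prod.ext rfl (by simp [hc])
      rw [e] at hm
      have h3 := DFunLike.congr_fun (hT.eq_zero_left _ hm) g₁
      have h4 := DFunLike.congr_fun hc g₀
      simp only [ContinuousMap.sub_apply, ContinuousMap.comp_apply, ContinuousMap.zero_apply,
        h0] at h3 h4
      rw [← h4, h3])
  refine ⟨g₀ * s, fun t ht => ?_⟩
  obtain ⟨z, -, hz⟩ := hT.le ht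
  rw [hz.apply_mul h₂ g₀ s.2]
  linear_combination -hs ⟨t, ht⟩

theorem IsMatching.nonempty_continuousMulEquiv [TotallyDisconnectedSpace G₁]
    [TotallyDisconnectedSpace G₂] {π₁ : C(G₁, I → ZMod (p ^ d))} {π₂ : C(G₂, I → ZMod (p ^ d))}
    {T} (hT : IsMatching π₁ π₂ T) (h₁ : IsFrattini (p ^ d) π₁) (h₂ : IsFrattini (p ^ d) π₂) :
    Nonempty (QuotCentral (p ^ d) G₁ 3 ≃ₜ* QuotCentral (p ^ d) G₂ 3) := by
  have hk₁ : ∀ g g' : G₁, (∀ t : T, t.1.1 g = t.1.1 g') ↔ g⁻¹ * g' ∈ qCentral (p ^ d) G₁ 3 := by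
    intro g g'
    rw [← h₁.forall_isInflation_iff]
    refine ⟨fun h f z hf => ?_, fun h t => ?_⟩
    · obtain ⟨f', hf'⟩ := hT.exists_right f z hf
      exact h ⟨_, hf'⟩
    · obtain ⟨z, hz, -⟩ := hT.le t.2
      exact h _ z hz
  have hk₂ : ∀ g g' : G₂, (∀ t : T, t.1.2 g = t.1.2 g') ↔ g⁻¹ * g' ∈ qCentral (p ^ d) G₂ 3 := by
    intro g g'
    rw [← h₂.forall_isInflation_iff]
    refine ⟨fun h f z hf => ?_, fun h t => ?_⟩
    · obtain ⟨f', hf'⟩ := hT.exists_left f z hf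
      exact h ⟨_, hf'⟩
    · obtain ⟨z, -, hz⟩ := hT.le t.2
      exact h _ z hz
  let e₁ : QuotCentral (p ^ d) G₁ 3 → T → ZMod (p ^ d) := Quotient.lift (fun g t => t.1.1 g)
    fun g g' h => funext ((hk₁ g g').2 (QuotientGroup.leftRel_apply.1 h))
  let e₂ : QuotCentral (p ^ d) G₂ 3 → T → ZMod (p ^ d) := Quotient.lift (fun g t => t.1.2 g)
    fun g g' h => funext ((hk₂ g g').2 (QuotientGroup.leftRel_apply.1 h))
  have hc₁ : Continuous e₁ := Continuous.quotient_lift (by fun_prop) _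
  have hc₂ : Continuous e₂ := Continuous.quotient_lift (by fun_prop) _
  have hi₁ : Function.Injective e₁ := by
    rintro ⟨g⟩ ⟨g'⟩ h
    exact QuotientGroup.eq.2 ((hk₁ g g').1 (congrFun h))
  have hi₂ : Function.Injective e₂ := by
    rintro ⟨g⟩ ⟨g'⟩ h
    exact QuotientGroup.eq.2 ((hk₂ g g').1 (congrFun h))
  have hr : Set.range e₁ = Set.range e₂ := by
    apply Set.Subset.antisymm
    · rintro _ ⟨⟨g⟩, rfl⟩
      obtain ⟨g', hg'⟩ := hT.exists_apply_eq h₂ g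
      exact ⟨QuotientGroup.mk g', funext fun t => (hg' t t.2).symm⟩
    · rintro _ ⟨⟨g⟩, rfl⟩
      obtain ⟨g', hg'⟩ := hT.swap.exists_apply_eq h₁ g
      exact ⟨QuotientGroup.mk g', funext fun t => (hg' (t.1.2, t.1.1) t.2).symm⟩
  -- Both evaluation maps are closed embeddings of compact spaces into (ℤ/q)^T with the same image.
  let η : QuotCentral (p ^ d) G₁ 3 ≃ₜ QuotCentral (p ^ d) G₂ 3 :=
    (hc₁.isClosedEmbedding hi₁).isEmbedding.toHomeomorph.trans ((Homeomorph.setCongr hr).trans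
      (hc₂.isClosedEmbedding hi₂).isEmbedding.toHomeomorph.symm)
  have hη : ∀ x, e₂ (η x) = e₁ x := by
    intro x
    exact congrArg Subtype.val ((hc₂.isClosedEmbedding hi₂).isEmbedding.toHomeomorph.apply_symm_apply
      (Homeomorph.setCongr hr ((hc₁.isClosedEmbedding hi₁).isEmbedding.toHomeomorph x)))
  refine ⟨{ η with map_mul' := fun x y => hi₂ ?_ }⟩
  change e₂ (η (x * y)) = e₂ (η x * η y)
  have hx := hη x
  have hy := hη y
  rw [hη]
  generalize η x = x' at *
  generalize η y = y' at *
  obtain ⟨x, rfl⟩ := QuotientGroup.mk_surjective x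
  obtain ⟨y, rfl⟩ := QuotientGroup.mk_surjective y
  obtain ⟨x', rfl⟩ := QuotientGroup.mk_surjective x'
  obtain ⟨y', rfl⟩ := QuotientGroup.mk_surjective y'
  replace hx : ∀ t : T, t.1.2 x' = t.1.1 x := congrFun hx
  replace hy : ∀ t : T, t.1.2 y' = t.1.1 y := congrFun hy
  have hπ : ∀ (u : G₁) (u' : G₂), (∀ t : T, t.1.2 u' = t.1.1 u) → π₂ u' = π₁ u := by
    intro u u' h
    ext i
    exact h ⟨_, hT.comp_mem ⟨fun a => a i, by fun_prop⟩⟩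
  funext t
  change t.1.1 (x * y) = t.1.2 (x' * y')
  -- Both entries of t satisfy the product formula with the same z, and corresponding points have
  -- equal images in (ℤ/q)^I.
  obtain ⟨z, hz1, hz2⟩ := hT.le t.2
  have h3 := hz1 x y
  have h4 := hz2 x' y'
  rw [hx, hy, hπ x x' hx, hπ y y' hy, ← h3] at h4
  linear_combination h4

end Reconstruction

/-! ### From cohomological relations to the isomorphism -/

section Kernel

variable {I : Type*} {q : ℕ} {G : Type*} [Group G] [TopologicalSpace G] [IsTopologicalGroup G]

/-- The map to a product of copies of `ℤ/q` defined by a family of continuous homomorphisms. -/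
def homProd (x : I → H1 G (ZMod q)) : C(G, I → ZMod q) :=
  ⟨fun g i => (x i).1 g, by fun_prop⟩

theorem H1.apply_eq_zero_of_mem_qCentral (χ : H1 G (ZMod q)) {g : G} (hg : g ∈ qCentral q G 2) :
    χ.1 g = 0 :=
  GaloisQuotient.apply_eq_zero_of_mem_qCentral (i := 0) χ.1 (fun _ _ _ => H1.map_mul χ _ _)
    (fun _ _ _ => H1.map_mul χ _ _) hg

theorem H1.smul_apply (c : ZMod q)
    (χ : H1 G (ZMod q)) (g : G) : (c • χ).1 g = c * χ.1 g := rfl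

/-- Surjectivity is duality applied to the linear independence of the basis. An element outside G⁽²⁾
is detected by some homomorphism, hence, as the basis spans, by some coordinate. -/
theorem isFrattini_homProd {p d : ℕ} [Fact p.Prime] [CompactSpace G] [TotallyDisconnectedSpace G]
    (b : Module.Basis I (ZMod (p ^ d)) (H1 G (ZMod (p ^ d)))) :
    IsFrattini (p ^ d) (homProd b) where
  map_mul x y := funext fun i => H1.map_mul _ x y
  surjective a := by
    obtain ⟨g, hg⟩ := exists_forall_apply_eq (fun i => (b i).1) (fun i => (b i).1.continuous)
      (fun i => H1.map_mul (b i)) a (fun s n h => by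
        have h0 : ∑ i ∈ s, n i • b i = 0 := by
          ext x
          rw [AddSubgroup.val_finsetSum, ContinuousMap.sum_apply]
          simp only [H1.smul_apply]
          exact h x
        exact Finset.sum_eq_zero fun i hi => by
          rw [linearIndependent_iff'.1 b.linearIndependent s n h0 i hi, zero_mul])
    exact ⟨g, funext hg⟩
  mem_iff g := by
    refine ⟨fun hg => funext fun i => H1.apply_eq_zero_of_mem_qCentral _ hg, fun h => ?_⟩
    by_contra hg
    obtain ⟨f, hf, -, hfg⟩ := exists_continuousMap_apply_ne_zero (qCentral (p ^ d) G 1)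
      (qCentral (p ^ d) G 2) (isClosed_qCentral _) (fun s hs x => commutator_mem_qCentral hs x)
      (fun s hs => pow_mem_qCentral hs) (Subgroup.mem_top g) hg
    have hχ : d₁ G (ZMod (p ^ d)) f = 0 := by
      ext x
      rw [d₁_apply, hf x.1 x.2 (Subgroup.mem_top _)]
      simp
    let K : Submodule (ZMod (p ^ d)) (H1 G (ZMod (p ^ d))) :=
      { carrier := {χ | χ.1 g = 0}
        zero_mem' := rfl
        add_mem' := fun {χ ψ} h h' => by
          change χ.1 g + ψ.1 g = 0
          rw [show χ.1 g = 0 from h, show ψ.1 g = 0 from h', add_zero]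
        smul_mem' := fun c χ h => by
          change (c • χ).1 g = 0
          rw [H1.smul_apply, show χ.1 g = 0 from h, mul_zero] }
    have hK : (⊤ : Submodule (ZMod (p ^ d)) (H1 G (ZMod (p ^ d)))) ≤ K := by
      rw [← b.span_eq, Submodule.span_le]
      rintro _ ⟨i, rfl⟩
      exact congrFun h i
    exact hfg (hK (x := ⟨f, hχ⟩) trivial)

/-- The combination of cup products and Bocksteins of a family in `H¹` with given coefficients. -/
def cupBockstein [NeZero q] (x : I → H1 G (ZMod q)) (s : Finset I) (c : I → I → ZMod q)
    (m : I → ZMod q) : H2 G (ZMod q) :=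
  ∑ i ∈ s, ∑ j ∈ s, (c i j).val • cup (x i) (x j) + ∑ i ∈ s, (m i).val • bockstein q G (x i)

theorem cupBockstein_eq_zero_iff [NeZero q] (x : I → H1 G (ZMod q)) (s : Finset I)
    (c : I → I → ZMod q) (m : I → ZMod q) : cupBockstein x s c m = 0 ↔
      ∃ f : C(G, ZMod q), ∀ g h, f h - f (g * h) + f g =
        ∑ i ∈ s, ∑ j ∈ s, c i j * ((x i).1 g * (x j).1 h) +
          ∑ i ∈ s, m i * bocksteinFun q ((x i).1 g) ((x i).1 h) := by
  let ζ : (d₂ G (ZMod q)).ker := ∑ i ∈ s, ∑ j ∈ s, (c i j).val •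
      (⟨cupCochain (x i).1 (x j).1, d₂_cupCochain (x i) (x j)⟩ : (d₂ G (ZMod q)).ker) +
    ∑ i ∈ s, (m i).val • (⟨bocksteinCochain (x i),
      d₂_eq_zero_of_incl (incl_bocksteinCochain (x i))⟩ : (d₂ G (ZMod q)).ker)
  have h1 : cupBockstein x s c m = QuotientAddGroup.mk' _ ζ := by
    simp only [ζ, map_add, map_sum, map_nsmul]
    rfl
  have h2 : ∀ g h, ζ.1 (g, h) = ∑ i ∈ s, ∑ j ∈ s, c i j * ((x i).1 g * (x j).1 h) +
      ∑ i ∈ s, m i * bocksteinFun q ((x i).1 g) ((x i).1 h) := by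
    intro g h
    have h3 : ∀ i, bocksteinCochain (x i) (g, h) = bocksteinFun q ((x i).1 g) ((x i).1 h) := by
      intro i
      rw [bocksteinFun, ← H1.map_mul]
      rfl
    simp only [ζ, AddSubgroup.coe_add, AddSubgroup.val_finsetSum, AddSubgroup.coe_nsmul,
      ContinuousMap.add_apply, ContinuousMap.sum_apply, ContinuousMap.nsmul_apply, h3, cupCochain,
      ContinuousMap.coe_mk]
    simp only [nsmul_eq_mul, ZMod.natCast_val, ZMod.cast_id', id_eq]
  rw [h1, QuotientAddGroup.mk'_apply, QuotientAddGroup.eq_zero_iff, AddSubgroup.mem_addSubgroupOf]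
  constructor
  · rintro ⟨f, hf⟩
    exact ⟨f, fun g h => by rw [← h2, ← hf, d₁_apply]⟩
  · rintro ⟨f, hf⟩
    exact ⟨f, by ext x; rw [d₁_apply, hf, ← h2]⟩

/-- Whether the inflation of a cochain is a coboundary is determined by the relations between cup
products and Bocksteins. -/
theorem exists_isInflation_iff [NeZero q] {G' : Type*} [Group G'] [TopologicalSpace G']
    [IsTopologicalGroup G'] {x : I → H1 G (ZMod q)} {x' : I → H1 G' (ZMod q)}
    (hx : IsFrattini q (homProd x))
    (h : ∀ s c m, cupBockstein x s c m = 0 ↔ cupBockstein x' s c m = 0)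
    {z : C((I → ZMod q) × (I → ZMod q), ZMod q)} (hz : ∃ f, IsInflation (homProd x) z f) :
    ∃ f, IsInflation (homProd x') z f := by
  obtain ⟨f, hf⟩ := hz
  -- The inflation of z is a coboundary, and π is surjective, so the cocycle identity already holds
  -- on (ℤ/q)^I.
  have hcoc : IsAddCocycle fun a b => z (a, b) := by
    intro a b c
    obtain ⟨u, rfl⟩ := hx.surjective a
    obtain ⟨v, rfl⟩ := hx.surjective b
    obtain ⟨w, rfl⟩ := hx.surjective c
    simp only [← hx.map_mul, ← hf _ _, mul_assoc]
    ring
  obtain ⟨s, c, m, e, he⟩ := hcoc.exists_eq_cup_add_bockstein_of_continuous (by fun_prop)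
  obtain ⟨f', hf'⟩ := (cupBockstein_eq_zero_iff x' s c m).1 ((h s c m).1
    ((cupBockstein_eq_zero_iff x s c m).2 ⟨f - e.comp (homProd x), fun g g' => by
      have h1 := (hf g g').trans (he _ _)
      rw [← hx.map_mul] at h1
      simp only [ContinuousMap.sub_apply, ContinuousMap.comp_apply]
      refine Eq.trans ?_ (sub_eq_iff_eq_add.2 h1)
      ring⟩))
  refine ⟨f' + e.comp (homProd x'), fun g g' => ?_⟩
  have h1 : homProd x' (g * g') = homProd x' g + homProd x' g' :=
    funext fun i => H1.map_mul _ g g'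
  refine Eq.trans ?_ (he _ _).symm
  refine Eq.trans ?_ (congrArg (· + _) (hf' g g'))
  simp only [ContinuousMap.add_apply, ContinuousMap.comp_apply, h1]
  ring

theorem exists_eq_smul_of_mem_homSubmodule {p d : ℕ}
    (hH : ∀ χ : H1 G (ZMod (p ^ d)), p • χ = 0 → ∃ ψ, χ = p ^ (d - 1) • ψ) :
    ∀ h ∈ homSubmodule (p ^ d) G, p • h = 0 →
      ∃ h' ∈ homSubmodule (p ^ d) G, h = p ^ (d - 1) • h' := by
  intro h hh h0
  obtain ⟨ψ, hψ⟩ := hH ⟨h, AddMonoidHom.mem_ker.2 (by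
    ext x
    simp [hh x.1 x.2])⟩ (Subtype.ext h0)
  exact ⟨ψ.1, H1.map_mul ψ, congrArg Subtype.val hψ⟩

/-- The quotient `G^{[3]}` of a profinite group whose `H¹` is a free `ℤ/q`-module is determined by
the cup product on `H¹` and the Bockstein homomorphism. -/
theorem nonempty_quotCentral_continuousMulEquiv {p d : ℕ} [Fact p.Prime] [CompactSpace G]
    [TotallyDisconnectedSpace G] {G' : Type*} [Group G'] [TopologicalSpace G']
    [IsTopologicalGroup G'] [CompactSpace G'] [TotallyDisconnectedSpace G']
    (hH : ∀ χ : H1 G (ZMod (p ^ d)), p • χ = 0 → ∃ ψ, χ = p ^ (d - 1) • ψ)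
    (φ₁ : H1 G (ZMod (p ^ d)) ≃+ H1 G' (ZMod (p ^ d)))
    (φ₂ : H2 G (ZMod (p ^ d)) ≃+ H2 G' (ZMod (p ^ d)))
    (hcup : ∀ a b, φ₂ (cup a b) = cup (φ₁ a) (φ₁ b))
    (hβ : ∀ a, φ₂ (bockstein (p ^ d) G a) = bockstein (p ^ d) G' (φ₁ a)) :
    Nonempty (QuotCentral (p ^ d) G 3 ≃ₜ* QuotCentral (p ^ d) G' 3) := by
  obtain ⟨I, ⟨b⟩⟩ := nonempty_basis_of_torsion hH
  let L : H1 G (ZMod (p ^ d)) ≃ₗ[ZMod (p ^ d)] H1 G' (ZMod (p ^ d)) :=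
    { φ₁.toAddMonoidHom.toZModLinearMap (p ^ d), φ₁ with }
  have hx := isFrattini_homProd b
  have hx' := isFrattini_homProd (b.map L)
  have hrel : ∀ s c m, cupBockstein b s c m = 0 ↔ cupBockstein (b.map L) s c m = 0 := by
    intro s c m
    have h1 : cupBockstein (b.map L) s c m = φ₂ (cupBockstein b s c m) := by
      simp only [cupBockstein, map_add, map_sum, map_nsmul, hcup, hβ]
      rfl
    rw [h1, EmbeddingLike.map_eq_zero_iff]
  -- Divisibility of p-torsion passes from H¹(G) to H¹(G') through φ₁.
  obtain ⟨T, hT⟩ := exists_isMatching hx hx' (exists_eq_smul_of_mem_homSubmodule fun χ h0 => by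
    obtain ⟨ψ, hψ⟩ := hH (φ₁.symm χ) (by rw [← map_nsmul, h0, map_zero])
    exact ⟨φ₁ ψ, by rw [← map_nsmul, ← hψ, AddEquiv.apply_symm_apply]⟩) fun z =>
      ⟨exists_isInflation_iff hx hrel, exists_isInflation_iff hx' fun s c m => (hrel s c m).symm⟩
  exact hT.nonempty_continuousMulEquiv hx hx'

end Kernel

end GaloisQuotient

end

open GaloisQuotient in
theorem theoremB (p d : ℕ) [Fact p.Prime] (hd : 1 ≤ d)
    (F₁ : Type*) [Field F₁] (F₂ : Type*) [Field F₂]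
    (hF₁ : ∃ ζ : F₁, IsPrimitiveRoot ζ (p ^ d))
    (hF₂ : ∃ ζ : F₂, IsPrimitiveRoot ζ (p ^ d))
    (φ₁ : H1 (AbsGal F₁) (ZMod (p ^ d)) ≃+ H1 (AbsGal F₂) (ZMod (p ^ d)))
    (φ₂ : H2 (AbsGal F₁) (ZMod (p ^ d)) ≃+ H2 (AbsGal F₂) (ZMod (p ^ d)))
    (hcup : ∀ a b : H1 (AbsGal F₁) (ZMod (p ^ d)), φ₂ (cup a b) = cup (φ₁ a) (φ₁ b))
    (hβ : ∀ a : H1 (AbsGal F₁) (ZMod (p ^ d)),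
      φ₂ (bockstein (p ^ d) (AbsGal F₁) a) = bockstein (p ^ d) (AbsGal F₂) (φ₁ a)) :
    Nonempty (QuotCentral (p ^ d) (AbsGal F₁) 3 ≃ₜ* QuotCentral (p ^ d) (AbsGal F₂) 3) := by
  obtain ⟨ζ, hζ⟩ := hF₁
  exact nonempty_quotCentral_continuousMulEquiv
    (fun χ hχ => H1.exists_eq_pow_smul_of_smul_eq_zero hd hζ χ hχ) φ₁ φ₂ hcup hβ
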